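/- Let $n,k,d$ be positive integers and let $K$ be an algebraically closed field of characteristic $0$ or $p>kd$. Let $W$ be a $K$-vector space with basis $w_0,\dots,w_n$ and dual basis $x_0,\dots,x_n$, so that $\mathrm{Sym}(W)=K[w_0,\dots,w_n]$ and $\mathrm{Sym}(W^*)=K[x_0,\dots,x_n]$, with the natural action of $\mathrm{GL}_{n+1}$ on $\mathrm{Sym}(W)$ and the contragredient action on $\mathrm{Sym}(W^*)$. Let $D:\mathrm{Sym}(W)\times\mathrm{Sym}(W^*)\to\mathrm{Sym}(W^*)$ be the bilinear map with $D(w^\alpha,P)=\partial^{\alpha}P/\partial x^\alpha$. A covariant (resp. contravariant) of order $e$ is an $\mathrm{SL}_{n+1}$-equivariant homogeneous polynomial map $\mathrm{Sym}^{kd}(W^*)\to\mathrm{Sym}^{e}(W^*)$ (resp. $\to \mathrm{Sym}^e(W)$), and an invariant is a covariant of order $0$, i.e. an $\mathrm{SL}_{n+1}$-invariant homogeneous polynomial function $\mathrm{Sym}^{kd}(W^*)\to K$. Let $r+1=\dim_K \mathrm{Sym}^d(W^*)$ and let $q_0,\dots,q_r$ be covariants of order $d$ of $\mathrm{Sym}^{kd}(W^*)$.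 Let $b_0,\dots,b_r$ be the monomials of degree $d$ in the $x_i$, in any order, let $b_j^*$ be the basis of $\mathrm{Sym}^d(W)$ dual to them for $D$ (so $b_j^*=w^\alpha/\alpha!$ if $b_j=x^\alpha$), let $S$ be the matrix whose $i$-th column consists of the coordinates of $q_i$ in $(b_j)$, and let $\Delta=\det S$. Let $\Delta q_i^*$ be the map whose coordinates in $(b_j^*)$ form the $i$-th column of $\Delta\,{}^tS^{-1}={}^t\mathrm{adj}(S)$. For $g\in \mathrm{Sym}^{kd}(W^*)$ put $$\tilde g=\sum_{0\le i_1,\dots,i_k\le r} D\big(\Delta q_{i_1}^*(g)\cdots\Delta q_{i_k}^*(g),\,g\big)\,X_{i_1}\cdots X_{i_k}\in K[X_0,\dots,X_r].$$ If $q_0(f),\dots,q_r(f)$ are linearly independent, let $\varphi_f:\mathbb P^n\to\mathbb P^r$ be the map $x\mapsto[q_0(f)(x):\cdots:q_r(f)(x)]$. Then: 1. $\Delta$ is an invariant, the $\Delta q_i^*$ are contravariants, and $D(\Delta q_i^*(g),q_j(g))=\Delta(g)\,\delta_{ij}$ for all $g,i,j$. Moreover $q_0(g),\dots,q_r(g)$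 are linearly independent if and only if $\Delta(g)\ne0$. 2. Each function $g\mapsto D(\Delta q_{i_1}^*(g)\cdots\Delta q_{i_k}^*(g),g)$, and each coefficient of $\tilde g$ as a polynomial in the $X_i$, is an invariant. 3. There are finitely many families of invariants $(c_{t,l,m})_{0\le l,m\le r}$, $t=1,\dots,s$, such that for every $f$ at which the $q_i$ are linearly independent, $\varphi_f$ is well defined (the $q_i(f)$ have no common zero in $\mathbb P^n$), the quadratic forms $Q_t=\sum_{l,m}c_{t,l,m}(f)X_lX_m$ have $\mathrm{Im}(\varphi_f)$ as their set of common zeros in $\mathbb P^r$, and they span the space of all quadratic forms $P$ with $P(q_0(f),\dots,q_r(f))=0$. 4. The entries of the matrix $M=\big(D(\Delta q_i^*\Delta q_j^*,\,q_lq_m)\big)_{(i,j),(l,m)}$ are invariants. If moreover $K$ has characteristic $0$ or $p>2d$ (which is automatic when $k\ge2$), then for every $f$ at which the $q_i$ are linearly independent, a vector $(c_{lm})$ lies in the right kernel of $M(f)$ if and only if $\sum_{l,m} c_{lm}\,q_l(f)q_m(f)=0$, and the common zeros in $\mathbb P^r$ of the quadratic forms $\sum_{l,m} c_{lm}X_lX_m$,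 with $(c_{lm})$ in that kernel, are exactly $\mathrm{Im}(\varphi_f)$. 5. There is a map $R$, independent of $f$ and of the $q_i$, that assigns to a polynomial in $K[X_0,\dots,X_r]$ and a set of such polynomials a form in $\mathrm{Sym}^{kd}(W^*)$, such that for every $f$ at which the $q_i$ are linearly independent and all quadratic forms $Q_1,\dots,Q_s$ whose set of common zeros in $\mathbb P^r$ is $\mathrm{Im}(\varphi_f)$, the form $f'=R(\tilde f,\{Q_1,\dots,Q_s\})$ is $\mathrm{GL}_{n+1}$-equivalent to $f$. More precisely, for all $q'_0,\dots,q'_r\in\mathrm{Sym}^d(W^*)$ without common zero in $\mathbb P^n$ such that the image of $x\mapsto[q_0'(x):\cdots:q'_r(x)]$ is the set of common zeros of the $Q_t$, the form $\tilde f(q'_0,\dots,q'_r)$ is $\mathrm{GL}_{n+1}$-equivalent to $f$. -/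

import Mathlib

open MvPolynomial
open scoped LinearAlgebra.Projectivization

namespace HypersurfaceReconstruction

noncomputable section

/-! Throughout, `W` is a `K`-vector space with basis `w₀, …, wₙ` and dual basis `x₀, …, xₙ`, so
that both `Sym(W) = K[w₀, …, wₙ]` and `Sym(W*) = K[x₀, …, xₙ]` are polynomial rings. -/

/-- `Sym(W*)`, the variable `X i` being the coordinate function `xᵢ`. -/
abbrev SymDual (K : Type*) [Field K] (n : ℕ) : Type _ := MvPolynomial (Fin (n + 1)) K

/-- `Sym(W)`, the variable `X i` being the basis vector `wᵢ`. -/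
abbrev SymPrimal (K : Type*) [Field K] (n : ℕ) : Type _ := MvPolynomial (Fin (n + 1)) K

/-- `Sym^m(W*)`: the forms of degree `m` in `x₀, …, xₙ`. -/
abbrev Form (K : Type*) [Field K] (n m : ℕ) : Type _ :=
  ↥(homogeneousSubmodule (Fin (n + 1)) K m : Submodule K (SymDual K n))

/-- `Sym^m(W)`: the forms of degree `m` in `w₀, …, wₙ`. -/
abbrev CoForm (K : Type*) [Field K] (n m : ℕ) : Type _ :=
  ↥(homogeneousSubmodule (Fin (n + 1)) K m : Submodule K (SymPrimal K n))

/-- Exponents of the monomials of degree `m` in `n + 1` variables. -/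
abbrev Exponent (n m : ℕ) : Type := {α : Fin (n + 1) →₀ ℕ // α.degree = m}

section Actions

variable {K : Type*} [Field K] {n : ℕ}

/-- The action of `GL(W)` on `Sym(W)` induced by `A • wⱼ = ∑ᵢ Aᵢⱼ wᵢ`. -/
def actPrimal (A : GL (Fin (n + 1)) K) : SymPrimal K n →ₐ[K] SymPrimal K n :=
  aeval fun j => ∑ i, C ((A : Matrix (Fin (n + 1)) (Fin (n + 1)) K) i j) * X i

/-- The contragredient action of `GL(W)` on `Sym(W*)`, induced by
`A • xⱼ = ∑ᵢ (ᵗA⁻¹)ᵢⱼ xᵢ`. -/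
def actDual (A : GL (Fin (n + 1)) K) : SymDual K n →ₐ[K] SymDual K n :=
  aeval fun j =>
    ∑ i, C (((A⁻¹ : GL (Fin (n + 1)) K) : Matrix (Fin (n + 1)) (Fin (n + 1)) K) j i) * X i

theorem isHomogeneous_actPrimal (A : GL (Fin (n + 1)) K) {m : ℕ} {p : SymPrimal K n}
    (hp : p.IsHomogeneous m) : (actPrimal A p).IsHomogeneous m := by
  have h := hp.aeval (fun j => ∑ i, C ((A : Matrix (Fin (n + 1)) (Fin (n + 1)) K) i j) * X i)
    (n := 1) (fun j => IsHomogeneous.sum _ _ _ fun i _ => isHomogeneous_C_mul_X _ i)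
  simpa [actPrimal] using h

theorem isHomogeneous_actDual (A : GL (Fin (n + 1)) K) {m : ℕ} {p : SymDual K n}
    (hp : p.IsHomogeneous m) : (actDual A p).IsHomogeneous m := by
  have h := hp.aeval (fun j => ∑ i, C (((A⁻¹ : GL (Fin (n + 1)) K) :
      Matrix (Fin (n + 1)) (Fin (n + 1)) K) j i) * X i)
    (n := 1) (fun j => IsHomogeneous.sum _ _ _ fun i _ => isHomogeneous_C_mul_X _ i)
  simpa [actDual] using h

/-- The action on `Sym^m(W)`. -/
def actCoForm (A : GL (Fin (n + 1)) K) {m : ℕ} (p : CoForm K n m) : CoForm K n m :=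
  ⟨actPrimal A p.1, isHomogeneous_actPrimal A p.2⟩

/-- The action on `Sym^m(W*)`. -/
def actForm (A : GL (Fin (n + 1)) K) {m : ℕ} (f : Form K n m) : Form K n m :=
  ⟨actDual A f.1, isHomogeneous_actDual A f.2⟩

/-- `f` and `f'` are `GL`-equivalent. -/
def GLEquivalent (f f' : SymDual K n) : Prop := ∃ A : GL (Fin (n + 1)) K, actDual A f = f'

end Actions

section Covariants

variable {K : Type*} [Field K] {n m : ℕ}

/-- `F : Sym^m(W*) → K` is a homogeneous polynomial of degree `e` in the coefficients of the
form. -/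
def IsHomogeneousPolyFun (e : ℕ) (F : Form K n m → K) : Prop :=
  ∃ P : MvPolynomial (Exponent n m) K, P.IsHomogeneous e ∧
    ∀ f : Form K n m, F f = eval (fun α => coeff α.1 f.1) P

/-- Invariants of `Sym^m(W*)`: homogeneous polynomial functions (of some degree) that are
`SL(W)`-invariant. -/
def IsInvariant (F : Form K n m → K) : Prop :=
  (∃ e, IsHomogeneousPolyFun e F) ∧
    ∀ (A : Matrix.SpecialLinearGroup (Fin (n + 1)) K) (f : Form K n m),
      F (actForm (A : GL (Fin (n + 1)) K) f) = F f

/-- Covariants of `Sym^m(W*)` of order `d`: homogeneous polynomial maps (of some degree)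
`Sym^m(W*) → Sym^d(W*)` that are `SL(W)`-equivariant. -/
def IsCovariant {d : ℕ} (c : Form K n m → Form K n d) : Prop :=
  (∃ e, ∀ β : Exponent n d, IsHomogeneousPolyFun e fun f => coeff β.1 (c f).1) ∧
    ∀ (A : Matrix.SpecialLinearGroup (Fin (n + 1)) K) (f : Form K n m),
      c (actForm (A : GL (Fin (n + 1)) K) f) = actForm (A : GL (Fin (n + 1)) K) (c f)

/-- Contravariants of `Sym^m(W*)` of order `d`: homogeneous polynomial maps (of some degree)
`Sym^m(W*) → Sym^d(W)` that are `SL(W)`-equivariant. -/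
def IsContravariant {d : ℕ} (c : Form K n m → CoForm K n d) : Prop :=
  (∃ e, ∀ β : Exponent n d, IsHomogeneousPolyFun e fun f => coeff β.1 (c f).1) ∧
    ∀ (A : Matrix.SpecialLinearGroup (Fin (n + 1)) K) (f : Form K n m),
      c (actForm (A : GL (Fin (n + 1)) K) f) = actCoForm (A : GL (Fin (n + 1)) K) (c f)

end Covariants

section Apolarity

variable {K : Type*} [Field K] {n : ℕ}

/-- The differential operator `∂^α = ∂^|α| / ∂x₀^α₀ ⋯ ∂xₙ^αₙ` on `Sym(W*)`. -/
def iteratedPartial (α : Fin (n + 1) →₀ ℕ) : Module.End K (SymDual K n) :=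
  (List.ofFn fun i => ((pderiv i : Derivation K (SymDual K n) (SymDual K n)) :
    Module.End K (SymDual K n)) ^ α i).prod

/-- The apolarity map `D : Sym(W) × Sym(W*) → Sym(W*)`, the bilinear map with
`D(w^α, P) = ∂^α P`. -/
def apolar : SymPrimal K n →ₗ[K] SymDual K n →ₗ[K] SymDual K n :=
  (basisMonomials (Fin (n + 1)) K).constr K iteratedPartial

/-- The scalar `D(p, P)` when `p` and `P` have the same degree, `Sym^0(W*)` being identified
with `K`. -/
def apolarScalar (p : SymPrimal K n) (P : SymDual K n) : K := constantCoeff (apolar p P)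

end Apolarity

section DualBasis

variable {K : Type*} [Field K] {n d r : ℕ}

/-- The element `w^α / α!` of the basis of `Sym^d(W)` dual to the monomial basis. -/
def dualMonomial (α : Exponent n d) : CoForm K n d :=
  ⟨monomial α.1 ((∏ i, ((α.1 i).factorial : K))⁻¹),
    isHomogeneous_monomial _ α.2⟩

/-- The matrix `S` of the coordinates of `p₀, …, pᵣ` (as columns) in the monomial basis of
`Sym^d(W*)`, enumerated by `b`. -/
def coeffMatrix (b : Fin (r + 1) ≃ Exponent n d) (p : Fin (r + 1) → Form K n d) :
    Matrix (Fin (r + 1)) (Fin (r + 1)) K :=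
  Matrix.of fun j i => coeff (b j).1 (p i).1

/-- `Δ = det S`. -/
def basisDet (b : Fin (r + 1) ≃ Exponent n d) (p : Fin (r + 1) → Form K n d) : K :=
  (coeffMatrix b p).det

/-- `Δ pᵢ*`, where `p*` is the dual basis: its coordinates in the dual basis of the monomials are
the `i`-th column of `Δ ᵗS⁻¹`, that is, of the transposed adjugate of `S`; as a polynomial
expression in `S` it makes sense even where `Δ = 0`. -/
def scaledDual (b : Fin (r + 1) ≃ Exponent n d) (p : Fin (r + 1) → Form K n d)
    (i : Fin (r + 1)) : CoForm K n d :=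
  ∑ j, (coeffMatrix b p).adjugate.transpose j i • dualMonomial (b j)

end DualBasis

section Reconstruction

variable {K : Type*} [Field K] {n d r m : ℕ}

/-- The scalar `D(Δq*_{i₁} ⋯ Δq*_{iₖ}, Id)(g)`. -/
def tildeCoeff {k : ℕ} (b : Fin (r + 1) ≃ Exponent n d)
    (q : Fin (r + 1) → Form K n m → Form K n d) (I : Fin k → Fin (r + 1)) (g : Form K n m) : K :=
  apolarScalar (∏ t, (scaledDual b (fun i => q i g) (I t)).1) g.1

/-- `∑ D(Δq*_{i₁} ⋯ Δq*_{iₖ}, Id)(g) X_{i₁} ⋯ X_{iₖ}`. -/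
def tildeForm (k : ℕ) (b : Fin (r + 1) ≃ Exponent n d)
    (q : Fin (r + 1) → Form K n m → Form K n d) (g : Form K n m) : MvPolynomial (Fin (r + 1)) K :=
  ∑ I : Fin k → Fin (r + 1), C (tildeCoeff b q I g) * ∏ t, X (I t)

/-- The matrix `(D(Δqᵢ* Δqⱼ*, q_l q_m)(g))`, with rows `(i, j)` and columns `(l, m)`. -/
def relationMatrix (b : Fin (r + 1) ≃ Exponent n d)
    (q : Fin (r + 1) → Form K n m → Form K n d) (g : Form K n m) :
    Matrix (Fin (r + 1) × Fin (r + 1)) (Fin (r + 1) × Fin (r + 1)) K :=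
  Matrix.of fun ij lm =>
    apolarScalar ((scaledDual b (fun i => q i g) ij.1).1 * (scaledDual b (fun i => q i g) ij.2).1)
      ((q lm.1 g).1 * (q lm.2 g).1)

/-- The quadratic form `∑ c_{lm} X_l X_m`. -/
def quadric (c : Fin (r + 1) × Fin (r + 1) → K) : MvPolynomial (Fin (r + 1)) K :=
  ∑ lm, C (c lm) * (X lm.1 * X lm.2)

/-- The forms `p₀, …, pᵣ` have no common zero in `ℙⁿ`. -/
def BasePointFree (p : Fin (r + 1) → Form K n d) : Prop :=
  ∀ v : Fin (n + 1) → K, v ≠ 0 → (fun i => eval v (p i).1) ≠ 0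

/-- The morphism `ℙⁿ → ℙʳ`, `x ↦ [p₀(x) : ⋯ : pᵣ(x)]`. -/
def projMap (p : Fin (r + 1) → Form K n d) (hp : BasePointFree p) :
    ℙ K (Fin (n + 1) → K) → ℙ K (Fin (r + 1) → K) :=
  fun x => Projectivization.mk K (fun i => eval x.rep (p i).1) (hp x.rep x.rep_nonzero)

/-- The value of `projMap` can be computed with any homogeneous coordinates. -/
theorem projMap_mk (p : Fin (r + 1) → Form K n d) (hp : BasePointFree p)
    (v : Fin (n + 1) → K) (hv : v ≠ 0) :
    projMap p hp (Projectivization.mk K v hv) =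
      Projectivization.mk K (fun i => eval v (p i).1) (hp v hv) := by
  obtain ⟨a, ha⟩ := Projectivization.exists_smul_eq_mk_rep K v hv
  rw [projMap, Projectivization.mk_eq_mk_iff']
  refine ⟨(a : K) ^ d, ?_⟩
  funext i
  have h : (Projectivization.mk K v hv).rep = (a : K) • v := by rw [← ha]; rfl
  have he : eval ((a : K) • v) (p i).1 = (a : K) ^ d * eval v (p i).1 := by
    have := (p i).2
    rw [mem_homogeneousSubmodule] at this
    rw [eval_eq, eval_eq, Finset.mul_sum]
    refine Finset.sum_congr rfl fun α hα => ?_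
    have hd : α.degree = d := by
      rw [Finsupp.degree_eq_weight_one]; exact this (mem_support_iff.mp hα)
    simp only [Pi.smul_apply, smul_eq_mul, mul_pow, Finset.prod_mul_distrib]
    rw [Finset.prod_pow_eq_pow_sum]
    have : ∑ i ∈ α.support, α i = d := by rw [← hd]; rfl
    rw [this]; ring
  simp only [Pi.smul_apply, smul_eq_mul]
  rw [h, he]

/-- The common zeros in `ℙʳ` of a set of forms in `X₀, …, Xᵣ`. -/
def zeroLocus (S : Set (MvPolynomial (Fin (r + 1)) K)) : Set (ℙ K (Fin (r + 1) → K)) :=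
  {y | ∀ Q ∈ S, eval y.rep Q = 0}

end Reconstruction

end

end HypersurfaceReconstruction

namespace HypersurfaceReconstruction

noncomputable section

/-! ### The apolarity map and the pairing in equal degrees -/

section ApolarityBasics

variable {K : Type*} [Field K] {n : ℕ}

/-! Two facts carry everything: where Δ ≠ 0 the qᵢ form a basis of Sym^d(W*), and all constructions
commute with linear changes of variables. Cramer's rule gives D(Δqᵢ*, qⱼ) = Δ δᵢⱼ without division.
SL acts on Sym^d(W*) with determinant 1 (`actDet_specialLinear`) and preserves apolarity
(`apolar_act`), so Δ is invariant, the Δqᵢ* are contravariants (`scaledDual_actForm`), and every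
scalar paired out of them and the qᵢ is invariant. Homogeneity is tracked by a small calculus of
polynomial maps (`IsPolyMap.bilinear`).

Quadrics. A quadratic relation between the qᵢ comes from the kernel of Sym^d(W*) ⊗ Sym^d(W*) →
Sym^{2d}(W*), which is spanned by the exchanges yz ⊗ y'z' - y'z ⊗ yz' with y, y' in W*
(`eq_of_exchange` is the combinatorial core). To produce these equivariantly, form ∑ⱼ D(∂c/∂wⱼ, P) ⊗
∂a/∂xⱼ; such tensors fill out W* ⊗ Sym^{d-1}(W*) (`exists_contraction_eq`). Taking c among the Δqᵢ*
and P, a among the qᵢ, and exchanging two such tensors, gives one relation for each six-tuple of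
indices. Its coefficients are invariants, and where Δ ≠ 0 these relations span all of them
(`mem_relationSpan_iff`). There φ_f is the Veronese embedding up to a linear change of target
coordinates, so the quadrics cut out its image (`zeroLocus_eq_range_projMap`). The matrix M detects
the same relations as soon as the pairing in degree 2d is perfect (`eq_zero_of_pairing_eq_zero`).

Reconstruction. The tensor ∑ Δqᵢ* ⊗ qᵢ is Δ times the canonical element ∑ w^α/α! ⊗ x^α, whose k-th
power reproduces forms of degree kd up to the factor (kd)!/(d!)^k. Hence f̃(q(f)) is a nonzero
multiple of f (`aeval_tildeForm_self`). If q' also parametrizes the image by forms of degree d, then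
q' followed by the inverse of φ_f is a self-map of ℙⁿ, and unique factorization shows it is linear
(`exists_linear_of_veronese`). So q' = c · (A • q(f)), f̃(q') is a multiple of A • f, and a scalar
matrix absorbs the multiple since K is algebraically closed. -/

theorem prod_ofFn_mul_of_commute {M : Type*} [Monoid M] {m : ℕ} (f g : Fin m → M)
    (h : ∀ i j, Commute (f i) (g j)) :
    (List.ofFn fun i => f i * g i).prod = (List.ofFn f).prod * (List.ofFn g).prod := by
  induction m with
  | zero => simp
  | succ m ih =>
    simp only [List.ofFn_succ, List.prod_cons]
    rw [ih _ _ fun i j => h i.succ j.succ]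
    have hc : Commute (List.ofFn fun i : Fin m => f i.succ).prod (g 0) := by
      refine Commute.list_prod_left _ _ fun x hx => ?_
      obtain ⟨i, rfl⟩ := (List.mem_ofFn' _ _).mp hx
      exact h _ _
    rw [mul_assoc, mul_assoc, ← mul_assoc (g 0), ← hc.eq]
    simp only [mul_assoc]

/-- The commutator of two derivations is a derivation, so it vanishes once it vanishes on the
variables. -/
theorem pderiv_commute (i j : Fin (n + 1)) :
    Commute ((pderiv i : Derivation K (SymDual K n) (SymDual K n)) : Module.End K (SymDual K n))
      ((pderiv j : Derivation K (SymDual K n) (SymDual K n)) : Module.End K (SymDual K n)) := by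
  refine LinearMap.ext fun P => ?_
  have h : ⁅(pderiv i : Derivation K (SymDual K n) (SymDual K n)),
      (pderiv j : Derivation K (SymDual K n) (SymDual K n))⁆ = 0 := by
    refine MvPolynomial.derivation_ext fun l => ?_
    rw [Derivation.commutator_apply, pderiv_X, pderiv_X]
    simp [Pi.single_apply, apply_ite]
  have := congrArg (fun D : Derivation K (SymDual K n) (SymDual K n) => D P) h
  rw [Derivation.commutator_apply] at this
  exact sub_eq_zero.mp this

theorem iteratedPartial_add (α β : Fin (n + 1) →₀ ℕ) :
    iteratedPartial (K := K) (α + β) = iteratedPartial α * iteratedPartial β := by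
  unfold iteratedPartial
  rw [← prod_ofFn_mul_of_commute _ _ fun i j => ((pderiv_commute (K := K) i j).pow_pow _ _)]
  simp [pow_add]

theorem iteratedPartial_zero : iteratedPartial (K := K) (0 : Fin (n + 1) →₀ ℕ) = 1 := by
  simp [iteratedPartial]

theorem prod_ofFn_eq_of_forall_ne {M : Type*} [Monoid M] {m : ℕ} (f : Fin m → M) (i : Fin m)
    (h : ∀ j, j ≠ i → f j = 1) : (List.ofFn f).prod = f i := by
  induction m with
  | zero => exact i.elim0
  | succ m ih =>
    rw [List.ofFn_succ, List.prod_cons]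
    induction i using Fin.cases with
    | zero =>
      have : (fun j : Fin m => f j.succ) = fun _ => 1 :=
        funext fun j => h _ (Fin.succ_ne_zero j)
      simp [this]
    | succ i' =>
      rw [h 0 (Fin.succ_ne_zero _).symm, one_mul]
      exact ih _ i' fun j hj => h _ fun e => hj (Fin.succ_injective _ e)

theorem iteratedPartial_single (i : Fin (n + 1)) :
    iteratedPartial (K := K) (Finsupp.single i 1) =
      ((pderiv i : Derivation K (SymDual K n) (SymDual K n)) : Module.End K (SymDual K n)) := by
  unfold iteratedPartial
  rw [prod_ofFn_eq_of_forall_ne _ i fun j hj => by simp [Finsupp.single_eq_of_ne hj]]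
  simp

theorem apolar_monomial_one (α : Fin (n + 1) →₀ ℕ) :
    apolar (monomial α (1 : K)) = iteratedPartial α := by
  have := (basisMonomials (Fin (n + 1)) K).constr_basis K (iteratedPartial (K := K)) α
  rwa [coe_basisMonomials] at this

/-- Constant-coefficient operators compose like their symbols, which makes Sym(W*) a module over
Sym(W). By bilinearity only monomials matter. -/
theorem apolar_mul (p q : SymPrimal K n) : apolar (p * q) = apolar p * apolar q := by
  have : (LinearMap.mul K (SymPrimal K n)).compr₂ apolar =
      (LinearMap.mul K (Module.End K (SymDual K n))).compl₁₂ apolar apolar := by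
    refine (basisMonomials (Fin (n + 1)) K).ext fun α => (basisMonomials _ K).ext fun β => ?_
    simp [apolar_monomial_one, monomial_mul, iteratedPartial_add]
  exact congrArg (fun f => f p q) this

theorem apolar_mul_apply (p q : SymPrimal K n) (P : SymDual K n) :
    apolar (p * q) P = apolar p (apolar q P) := by rw [apolar_mul]; rfl

theorem apolar_one : apolar (1 : SymPrimal K n) = 1 := by
  rw [← iteratedPartial_zero, ← apolar_monomial_one]; rfl

theorem apolar_X (i : Fin (n + 1)) (P : SymDual K n) :
    apolar (X i : SymPrimal K n) P = pderiv i P := by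
  rw [X, apolar_monomial_one, iteratedPartial_single]; rfl

theorem apolar_C (c : K) (P : SymDual K n) : apolar (C c : SymPrimal K n) P = c • P := by
  rw [show (C c : SymPrimal K n) = c • 1 by rw [smul_eq_C_mul, mul_one], map_smul, apolar_one]; rfl

/-- When `α ≤ β` fails the truncated exponent is meaningless, but then some descending factorial
vanishes, so no case distinction is needed. -/
theorem apolar_monomial (α β : Fin (n + 1) →₀ ℕ) (a c : K) :
    apolar (monomial α a) (monomial β c) =
      monomial (β - α) (a * c * ∏ i, ((β i).descFactorial (α i) : K)) := by
  suffices h : ∀ (α β : Fin (n + 1) →₀ ℕ) (c : K), apolar (monomial α (1 : K)) (monomial β c) =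
      monomial (β - α) (c * ∏ i, ((β i).descFactorial (α i) : K)) by
    rw [show monomial α a = a • monomial α (1 : K) by simp [smul_monomial], map_smul,
      LinearMap.smul_apply, h, smul_monomial, smul_eq_mul, mul_assoc]
  have hadd : ∀ α α' : Fin (n + 1) →₀ ℕ,
      (∀ β (c : K), apolar (monomial α (1 : K)) (monomial β c) =
        monomial (β - α) (c * ∏ i, ((β i).descFactorial (α i) : K))) →
      (∀ β (c : K), apolar (monomial α' (1 : K)) (monomial β c) =
        monomial (β - α') (c * ∏ i, ((β i).descFactorial (α' i) : K))) →
      ∀ β (c : K), apolar (monomial (α + α') (1 : K)) (monomial β c) =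
        monomial (β - (α + α')) (c * ∏ i, ((β i).descFactorial ((α + α') i) : K)) := by
    intro α α' h h' β c
    rw [show monomial (α + α') (1 : K) = monomial α 1 * monomial α' 1 by simp [monomial_mul],
      apolar_mul_apply, h', h, tsub_tsub, add_comm α' α, mul_assoc, ← Finset.prod_mul_distrib]
    congr 2
    refine Finset.prod_congr rfl fun i _ => ?_
    rw [← Nat.descFactorial_mul_descFactorial (n := β i) (k := α' i) (m := (α + α') i) (by simp)]
    simp [mul_comm]
  intro α
  induction α using Finsupp.induction_linear with
  | zero => intro β c; simp [apolar_one, ← C_apply]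
  | add α α' h h' => exact hadd α α' h h'
  | single i k =>
    induction k with
    | zero => intro β c; simp [apolar_one, ← C_apply]
    | succ k ih =>
      rw [Finsupp.single_add]
      refine hadd _ _ ih fun β c => ?_
      rw [← X, apolar_X, pderiv_monomial, Finset.prod_eq_single i]
      · simp
      · intro j _ hj; simp [Finsupp.single_eq_of_ne hj]
      · simp

/-- The scalar `D(p, P)`, bilinear in `p` and `P`. -/
def pairing : SymPrimal K n →ₗ[K] SymDual K n →ₗ[K] K :=
  apolar.compr₂ (lcoeff K 0)

theorem pairing_apply (p : SymPrimal K n) (P : SymDual K n) : pairing p P = apolarScalar p P := rfl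

theorem pairing_monomial {m : ℕ} {α β : Fin (n + 1) →₀ ℕ} (hα : α.degree = m) (hβ : β.degree = m)
    (a c : K) : pairing (monomial α a) (monomial β c) =
      if α = β then a * c * ∏ i, ((α i).factorial : K) else 0 := by
  rw [pairing_apply, apolarScalar, apolar_monomial]
  split_ifs with h
  · subst h; simp [Nat.descFactorial_self]
  · obtain ⟨i, hi⟩ : ∃ i, β i < α i := by
      by_contra! hc
      refine h (Finsupp.ext fun i => ?_)
      rw [Finsupp.degree_eq_sum] at hα hβ
      exact (Finset.sum_eq_sum_iff_of_le fun i _ => hc i).mp (hα.trans hβ.symm) i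
        (Finset.mem_univ i)
    rw [Finset.prod_eq_zero (Finset.mem_univ i)]
    · simp
    · rw [Nat.descFactorial_of_lt hi, Nat.cast_zero]

theorem pairing_monomial_right {m : ℕ} {α : Fin (n + 1) →₀ ℕ} (hα : α.degree = m) (a : K)
    {P : SymDual K n} (hP : P.IsHomogeneous m) :
    pairing (monomial α a) P = a * (∏ i, ((α i).factorial : K)) * coeff α P := by
  conv_lhs => rw [P.as_sum, map_sum]
  rw [Finset.sum_congr rfl fun β hβ => pairing_monomial (m := m) (β := β) hα
    (by rw [Finsupp.degree_eq_weight_one]; exact hP (mem_support_iff.mp hβ)) a (coeff β P)]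
  rw [Finset.sum_ite_eq]
  split_ifs with h
  · ring
  · rw [notMem_support_iff.mp h, mul_zero]

theorem _root_.MvPolynomial.IsHomogeneous.apolar {a b : ℕ} {p : SymPrimal K n} {P : SymDual K n}
    (hp : p.IsHomogeneous a) (hP : P.IsHomogeneous (a + b)) :
    (HypersurfaceReconstruction.apolar p P).IsHomogeneous b := by
  rw [p.as_sum, P.as_sum]
  simp only [map_sum, LinearMap.sum_apply]
  refine IsHomogeneous.sum _ _ _ fun β hβ => IsHomogeneous.sum _ _ _ fun α hα => ?_
  have h1 : α.degree = a := by
    rw [Finsupp.degree_eq_weight_one]; exact hp (mem_support_iff.mp hα)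
  have h2 : β.degree = a + b := by
    rw [Finsupp.degree_eq_weight_one]; exact hP (mem_support_iff.mp hβ)
  rw [apolar_monomial]
  by_cases h : α ≤ β
  · refine isHomogeneous_monomial _ ?_
    have := congrArg Finsupp.degree (add_tsub_cancel_of_le h)
    rw [map_add] at this
    omega
  · obtain ⟨i, hi⟩ : ∃ i, β i < α i := by
      by_contra! hc; exact h hc
    rw [Finset.prod_eq_zero (Finset.mem_univ i)]
    · simpa using isHomogeneous_zero _ _ _
    · rw [Nat.descFactorial_of_lt hi, Nat.cast_zero]

theorem apolar_eq_C {m : ℕ} {p : SymPrimal K n} {P : SymDual K n}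
    (hp : p.IsHomogeneous m) (hP : P.IsHomogeneous m) : apolar p P = C (pairing p P) := by
  have h : (apolar p P).totalDegree = 0 := by
    have := hp.apolar (b := 0) hP
    exact Nat.le_zero.mp this.totalDegree_le
  exact (totalDegree_eq_zero_iff_eq_C.mp h)

theorem factorial_ne_zero_of_lt_ringChar {m : ℕ} (h : ringChar K = 0 ∨ m < ringChar K) :
    (m.factorial : K) ≠ 0 := by
  rw [Ne, ringChar.spec]
  rcases h with h | h
  · rw [h, zero_dvd_iff]; exact m.factorial_ne_zero
  · rcases CharP.char_is_prime_or_zero K (ringChar K) with hp | h0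
    · rw [hp.dvd_factorial]; omega
    · omega

theorem prod_factorial_ne_zero {m : ℕ} (h : ringChar K = 0 ∨ m < ringChar K)
    {α : Fin (n + 1) →₀ ℕ} (hα : α.degree ≤ m) : (∏ i, ((α i).factorial : K)) ≠ 0 :=
  Finset.prod_ne_zero_iff.mpr fun i _ => factorial_ne_zero_of_lt_ringChar <|
    h.imp id fun h => ((Finsupp.le_degree i α).trans hα).trans_lt h

end ApolarityBasics

/-! ### Equivariance of apolarity under GL -/

section Equivariance

variable {K : Type*} [Field K] {n : ℕ}

/-- The chain rule for a linear change of variables. -/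
theorem pderiv_aeval_linear (B : Fin (n + 1) → Fin (n + 1) → K) (i : Fin (n + 1))
    (p : MvPolynomial (Fin (n + 1)) K) :
    pderiv i (aeval (fun j => ∑ l, C (B j l) * X l : _ → MvPolynomial (Fin (n + 1)) K) p) =
      ∑ j, C (B j i) *
        aeval (fun j => ∑ l, C (B j l) * X l : _ → MvPolynomial (Fin (n + 1)) K) (pderiv j p) := by
  induction p using MvPolynomial.induction_on with
  | C a => simp
  | add p q hp hq => simp only [map_add, hp, hq, mul_add, Finset.sum_add_distrib]
  | mul_X p k hp =>
    simp only [map_mul, aeval_X, Derivation.leibniz, smul_eq_mul, map_add, mul_add,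
      Finset.sum_add_distrib, hp, pderiv_X]
    simp [Pi.single_apply, apply_ite, Finset.mul_sum]
    ring_nf

theorem pderiv_actPrimal (A : GL (Fin (n + 1)) K) (i : Fin (n + 1)) (p : SymPrimal K n) :
    pderiv i (actPrimal A p) = ∑ j, C (A i j) * actPrimal A (pderiv j p) :=
  pderiv_aeval_linear (fun j i => A i j) i p

theorem pderiv_actDual (A : GL (Fin (n + 1)) K) (i : Fin (n + 1)) (P : SymDual K n) :
    pderiv i (actDual A P) = ∑ j, C ((A⁻¹ : GL (Fin (n + 1)) K) j i) * actDual A (pderiv j P) :=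
  pderiv_aeval_linear (fun j i => (A⁻¹ : GL (Fin (n + 1)) K) j i) i P

theorem sum_inv_mul (A : GL (Fin (n + 1)) K) (j l : Fin (n + 1)) :
    ∑ i, (A⁻¹ : GL (Fin (n + 1)) K) j i * A i l = if j = l then 1 else 0 := by
  have := congrArg (fun M : GL (Fin (n + 1)) K => (M : Matrix _ _ K) j l) (inv_mul_cancel A)
  simpa only [Units.val_mul, Matrix.mul_apply, Units.val_one, Matrix.one_apply] using this

/-- Since `apolar` is multiplicative in its first argument, one variable wₗ can be moved at a time;
for it the chain rule brings in A⁻¹, which cancels the A acting on wₗ. -/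
theorem apolar_act (A : GL (Fin (n + 1)) K) (p : SymPrimal K n) (P : SymDual K n) :
    apolar (actPrimal A p) (actDual A P) = actDual A (apolar p P) := by
  induction p using MvPolynomial.induction_on generalizing P with
  | C a => simp [actPrimal, apolar_C, ← algebraMap_eq]
  | add p q hp hq => simp [hp, hq]
  | mul_X p l hp =>
    rw [map_mul, apolar_mul_apply, apolar_mul_apply, ← hp, apolar_X]
    congr 1
    simp only [actPrimal, aeval_X, map_sum, LinearMap.sum_apply, apolar_mul_apply, apolar_C,
      apolar_X, pderiv_actDual, smul_eq_C_mul]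
    rw [Finset.sum_comm]
    simp only [← mul_assoc, ← C_mul, ← Finset.sum_mul, ← map_sum, mul_comm (A _ l), sum_inv_mul]
    simp

theorem coeff_zero_actDual (A : GL (Fin (n + 1)) K) (P : SymDual K n) :
    coeff 0 (actDual A P) = coeff 0 P := by
  have : (constantCoeff.comp (actDual A : SymDual K n →+* SymDual K n)) = constantCoeff :=
    MvPolynomial.ringHom_ext (by simp [actDual]) (by simp [actDual])
  exact congrArg (fun f => f P) this

theorem pairing_act (A : GL (Fin (n + 1)) K) (p : SymPrimal K n) (P : SymDual K n) :
    pairing (actPrimal A p) (actDual A P) = pairing p P := by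
  change coeff 0 (apolar _ _) = coeff 0 (apolar _ _)
  rw [apolar_act, coeff_zero_actDual]

theorem actDual_mul (A B : GL (Fin (n + 1)) K) (P : SymDual K n) :
    actDual (A * B) P = actDual A (actDual B P) := by
  have : actDual (A * B) = (actDual A).comp (actDual B) := by
    refine MvPolynomial.algHom_ext fun j => ?_
    simp only [actDual, AlgHom.comp_apply, aeval_X, map_sum, map_mul, algHom_C, algebraMap_eq,
      mul_inv_rev, Units.val_mul, Matrix.mul_apply, Finset.mul_sum, Finset.sum_mul]
    rw [Finset.sum_comm]
    simp only [mul_assoc]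
  rw [this]; rfl

theorem actDual_one (P : SymDual K n) : actDual 1 P = P := by
  have : actDual (1 : GL (Fin (n + 1)) K) = AlgHom.id K _ := by
    refine MvPolynomial.algHom_ext fun j => ?_
    simp [actDual, Matrix.one_apply]
  rw [this]; rfl

end Equivariance

/-! ### The determinant of the action on Sym^d(W*) -/

section CoeffMatrix

variable {K : Type*} [Field K] {n d r : ℕ}

/-- The monomial `x^α` as a form. -/
def monomialForm (α : Exponent n d) : Form K n d := ⟨monomial α.1 1, isHomogeneous_monomial _ α.2⟩

theorem ext_of_isHomogeneous {p q : MvPolynomial (Fin (n + 1)) K} (hp : p.IsHomogeneous d)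
    (hq : q.IsHomogeneous d) (h : ∀ α : Exponent n d, coeff α.1 p = coeff α.1 q) : p = q := by
  refine MvPolynomial.ext _ _ fun α => ?_
  by_cases hα : α.degree = d
  · exact h ⟨α, hα⟩
  · rw [hp.coeff_eq_zero hα, hq.coeff_eq_zero hα]

theorem coeff_sum_smul_monomial (b : Fin (r + 1) ≃ Exponent n d) (c a : Fin (r + 1) → K)
    (j : Fin (r + 1)) :
    coeff (b j).1 (∑ l, c l • monomial (b l).1 (a l)) = c j * a j := by
  rw [coeff_sum, Finset.sum_eq_single j]
  · simp
  · intro l _ hl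
    have : (b l).1 ≠ (b j).1 := fun h => hl (b.injective (Subtype.ext h))
    simp [coeff_monomial, this]
  · simp

theorem eq_sum_coeff_smul (b : Fin (r + 1) ≃ Exponent n d) {p : MvPolynomial (Fin (n + 1)) K}
    (hp : p.IsHomogeneous d) : p = ∑ j, coeff (b j).1 p • monomial (b j).1 1 := by
  refine ext_of_isHomogeneous hp (IsHomogeneous.sum _ _ _ fun j _ => ?_) fun α => ?_
  · exact (homogeneousSubmodule _ _ d).smul_mem _ (isHomogeneous_monomial _ (b j).2)
  · obtain ⟨j, rfl⟩ := b.surjective α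
    rw [coeff_sum_smul_monomial, mul_one]

/-- The matrix of `A` acting on `Sym^d(W*)` in the monomial basis. -/
def actMatrix (b : Fin (r + 1) ≃ Exponent n d) (A : GL (Fin (n + 1)) K) :
    Matrix (Fin (r + 1)) (Fin (r + 1)) K :=
  coeffMatrix b fun j => actForm A (monomialForm (b j))

theorem coeffMatrix_actForm (b : Fin (r + 1) ≃ Exponent n d) (A : GL (Fin (n + 1)) K)
    (p : Fin (r + 1) → Form K n d) :
    coeffMatrix b (fun i => actForm A (p i)) = actMatrix b A * coeffMatrix b p := by
  ext j i
  rw [Matrix.mul_apply]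
  change coeff (b j).1 (actDual A (p i).1) = _
  conv_lhs => rw [eq_sum_coeff_smul b (p i).2]
  simp only [map_sum, map_smul, coeff_sum, coeff_smul, smul_eq_mul]
  exact Finset.sum_congr rfl fun l _ => mul_comm _ _

theorem actMatrix_one (b : Fin (r + 1) ≃ Exponent n d) :
    actMatrix b (1 : GL (Fin (n + 1)) K) = 1 := by
  ext j i
  change coeff (b j).1 (actDual 1 (monomial (b i).1 1)) = _
  rw [actDual_one, coeff_monomial, Matrix.one_apply]
  simp only [Subtype.val_inj, b.injective.eq_iff, eq_comm]

theorem actMatrix_mul (b : Fin (r + 1) ≃ Exponent n d) (A B : GL (Fin (n + 1)) K) :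
    actMatrix b (A * B) = actMatrix b A * actMatrix b B := by
  conv_rhs => rw [actMatrix.eq_1 b B, ← coeffMatrix_actForm]
  refine congrArg (coeffMatrix b) (funext fun j => Subtype.ext ?_)
  exact actDual_mul A B _

/-- The determinant of the action on `Sym^d(W*)`. -/
def actDet (b : Fin (r + 1) ≃ Exponent n d) : GL (Fin (n + 1)) K →* K where
  toFun A := (actMatrix b A).det
  map_one' := by rw [actMatrix_one, Matrix.det_one]
  map_mul' A B := by rw [actMatrix_mul, Matrix.det_mul]

/-- Monomials are eigenvectors. Swapping variables permutes the monomials of degree d, so all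
variables have the same total exponent N and the determinant is (∏ D i)^N. -/
theorem actDet_diagonal (b : Fin (r + 1) ≃ Exponent n d) (A : GL (Fin (n + 1)) K)
    (D : Fin (n + 1) → K) (hA : ((A⁻¹ : GL (Fin (n + 1)) K) : Matrix _ _ K) = Matrix.diagonal D)
    (hD : ∏ i, D i = 1) : actDet b A = 1 := by
  have hmat : actMatrix b A = Matrix.diagonal fun j => ∏ i, D i ^ (b j).1 i := by
    ext j l
    change coeff (b j).1 (actDual A (monomial (b l).1 1)) = _
    have : actDual A (monomial (b l).1 1) = monomial (b l).1 (∏ i, D i ^ (b l).1 i) := by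
      have hX : (fun j : Fin (n + 1) => ∑ i,
          C (((A⁻¹ : GL (Fin (n + 1)) K) : Matrix _ _ K) j i) * X i) =
          fun j => C (D j) * (X j : SymDual K n) := by
        funext j
        rw [hA, Finset.sum_eq_single j]
        · simp
        · intro i _ hi; simp [Matrix.diagonal_apply_ne' _ hi]
        · simp
      rw [actDual, hX, aeval_monomial, map_one, one_mul,
        Finsupp.prod_fintype _ _ fun i => pow_zero _]
      simp only [mul_pow, Finset.prod_mul_distrib, ← C_pow, ← map_prod]
      rw [monomial_eq, Finsupp.prod_fintype _ _ fun i => pow_zero _]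
    rw [this, coeff_monomial, Matrix.diagonal_apply]
    by_cases h : j = l
    · subst h; simp
    · have : (b l).1 ≠ (b j).1 := fun e => h (b.injective (Subtype.ext e)).symm
      rw [if_neg this, if_neg h]
  change (actMatrix b A).det = 1
  rw [hmat, Matrix.det_diagonal, Finset.prod_comm]
  simp only [Finset.prod_pow_eq_pow_sum]
  have hN : ∀ i, ∑ j, (b j).1 i = ∑ j, (b j).1 0 := by
    intro i
    let s : Exponent n d ≃ Exponent n d :=
      { toFun := fun α => ⟨α.1.equivMapDomain (Equiv.swap 0 i), by
          rw [Finsupp.equivMapDomain_eq_mapDomain, Finsupp.degree_mapDomain]; exact α.2⟩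
        invFun := fun α => ⟨α.1.equivMapDomain (Equiv.swap 0 i), by
          rw [Finsupp.equivMapDomain_eq_mapDomain, Finsupp.degree_mapDomain]; exact α.2⟩
        left_inv := fun α => Subtype.ext <| Finsupp.ext fun l => by simp
        right_inv := fun α => Subtype.ext <| Finsupp.ext fun l => by simp }
    refine Fintype.sum_equiv ((b.trans s).trans b.symm) _ _ fun j => ?_
    simp [s]
  rw [Finset.prod_congr rfl fun i _ => by rw [hN i], Finset.prod_pow, hD, one_pow]

/-- A diagonal matrix with entry a at place i conjugates the transvection of parameter x into that
of parameter ax, while a character with values in K ignores conjugation. An a other than 0 and 1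
then forces the character to be trivial. -/
theorem actDet_transvection [Infinite K] (b : Fin (r + 1) ≃ Exponent n d) {i j : Fin (n + 1)}
    (hij : i ≠ j) (c : K) :
    actDet b (Matrix.SpecialLinearGroup.transvection hij c : GL (Fin (n + 1)) K) = 1 := by
  have hadd : ∀ x y : K, (Matrix.SpecialLinearGroup.transvection hij (x + y) :
      Matrix.SpecialLinearGroup (Fin (n + 1)) K) =
      Matrix.SpecialLinearGroup.transvection hij x *
        Matrix.SpecialLinearGroup.transvection hij y := fun x y => Subtype.ext <| by
    exact (Matrix.transvection_mul_transvection_same _ _ hij x y).symm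
  obtain ⟨a, ha⟩ := Set.Infinite.nonempty (Set.toFinite ({0, 1} : Set K)).infinite_compl
  obtain ⟨ha0, ha1⟩ : a ≠ 0 ∧ a ≠ 1 := by simpa [not_or] using ha
  let D : GL (Fin (n + 1)) K := Matrix.GeneralLinearGroup.mkOfDetNeZero
    (Matrix.diagonal (Function.update 1 i a)) (by
      rw [Matrix.det_diagonal]
      refine Finset.prod_ne_zero_iff.mpr fun l _ => ?_
      by_cases h : l = i <;> simp [h, ha0])
  have hconj : ∀ x : K,
      D * (Matrix.SpecialLinearGroup.transvection hij x : GL (Fin (n + 1)) K) =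
        (Matrix.SpecialLinearGroup.transvection hij (a * x) : GL (Fin (n + 1)) K) * D := by
    intro x
    refine Units.ext ?_
    change Matrix.diagonal (Function.update 1 i a) * Matrix.transvection i j x =
      Matrix.transvection i j (a * x) * Matrix.diagonal (Function.update 1 i a)
    rw [Matrix.transvection, Matrix.transvection, mul_add, add_mul, mul_one, one_mul]
    congr 1
    ext k l
    rw [Matrix.diagonal_mul, Matrix.mul_diagonal, Matrix.single_apply, Matrix.single_apply]
    by_cases h : i = k ∧ j = l
    · obtain ⟨rfl, rfl⟩ := h
      simp [hij.symm]
    · simp [h]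
  have hunit : actDet b D ≠ 0 := fun h => by
    have := map_mul (actDet b) D D⁻¹
    rw [mul_inv_cancel, map_one, h, zero_mul] at this
    exact one_ne_zero this
  -- The parameter x = c/(a - 1) solves ax = c + x, so the factor belonging to c is all that remains
  -- after cancellation.
  have h := congrArg (actDet b) (hconj (c / (a - 1)))
  rw [map_mul, map_mul, mul_comm] at h
  have h := mul_right_cancel₀ hunit h
  rw [show a * (c / (a - 1)) = c + c / (a - 1) by field_simp [sub_ne_zero.mpr ha1]; ring,
    hadd, map_mul, map_mul] at h
  refine mul_right_cancel₀ ?_ (h.symm.trans (one_mul _).symm)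
  intro h0
  have := map_mul (actDet b) (Matrix.SpecialLinearGroup.transvection hij (c / (a - 1)) :
    GL (Fin (n + 1)) K) (Matrix.SpecialLinearGroup.transvection hij (c / (a - 1)) :
    GL (Fin (n + 1)) K)⁻¹
  rw [mul_inv_cancel, map_one, h0, zero_mul] at this
  exact one_ne_zero this

/-- SL is generated by transvections and by diagonal matrices with entries c, c⁻¹ at two places.
This is what turns relative invariance of Δ into invariance. -/
theorem actDet_specialLinear [Infinite K] (b : Fin (r + 1) ≃ Exponent n d) (hn : 0 < n)
    (A : Matrix.SpecialLinearGroup (Fin (n + 1)) K) :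
    actDet b (A : GL (Fin (n + 1)) K) = 1 := by
  have : Nontrivial (Fin (n + 1)) := Fin.nontrivial_iff_two_le.mpr (by omega)
  induction A using Matrix.SpecialLinearGroup.diagonal_transvection_induction' with
  | hdiag i j hij hc =>
    rename_i c
    refine actDet_diagonal b _ (fun k => if k = i then c⁻¹ else if k = j then c else 1) ?_ ?_
    · rw [← map_inv]
      have : (Matrix.SpecialLinearGroup.diag2n hij c hc)⁻¹ =
          Matrix.SpecialLinearGroup.diag2n hij c⁻¹ (inv_ne_zero hc) := by
        refine inv_eq_of_mul_eq_one_right (Subtype.ext ?_)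
        simp only [Matrix.SpecialLinearGroup.coe_mul, Matrix.SpecialLinearGroup.diag2n_coe,
          Matrix.diagonal_mul_diagonal, Matrix.SpecialLinearGroup.coe_one, ← Matrix.diagonal_one]
        congr 1
        funext k
        split_ifs <;> simp [hc]
      rw [this]
      change (Matrix.SpecialLinearGroup.diag2n hij c⁻¹ (inv_ne_zero hc)).1 = _
      rw [Matrix.SpecialLinearGroup.diag2n_coe, inv_inv]
    · have := (Matrix.SpecialLinearGroup.diag2n hij c⁻¹ (inv_ne_zero hc)).2
      rwa [Matrix.SpecialLinearGroup.diag2n_coe, inv_inv, Matrix.det_diagonal] at this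
  | htransvec i j hij a => exact actDet_transvection b hij a
  | hmul A B hA hB => rw [map_mul, map_mul, hA, hB, one_mul]

end CoeffMatrix

/-! ### The scaled dual basis -/

section DualBasis

variable {K : Type*} [Field K] {n d r : ℕ}

theorem basisDet_actForm (b : Fin (r + 1) ≃ Exponent n d) (A : GL (Fin (n + 1)) K)
    (p : Fin (r + 1) → Form K n d) :
    basisDet b (fun i => actForm A (p i)) = actDet b A * basisDet b p := by
  rw [basisDet, coeffMatrix_actForm, Matrix.det_mul]; rfl

theorem coe_scaledDual (b : Fin (r + 1) ≃ Exponent n d) (p : Fin (r + 1) → Form K n d)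
    (i : Fin (r + 1)) : (scaledDual b p i).1 =
      ∑ j, (coeffMatrix b p).adjugate i j • (dualMonomial (b j) : CoForm K n d).1 := by
  rw [scaledDual, AddSubmonoidClass.coe_finsetSum]; rfl

theorem pairing_dualMonomial (hd : ringChar K = 0 ∨ d < ringChar K) (α : Exponent n d)
    {P : SymDual K n} (hP : P.IsHomogeneous d) :
    pairing (dualMonomial α : CoForm K n d).1 P = coeff α.1 P := by
  change pairing (monomial α.1 _) P = _
  rw [pairing_monomial_right α.2 _ hP, inv_mul_cancel₀ (prod_factorial_ne_zero hd α.2.le), one_mul]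

theorem pairing_scaledDual (hd : ringChar K = 0 ∨ d < ringChar K)
    (b : Fin (r + 1) ≃ Exponent n d) (p : Fin (r + 1) → Form K n d) (i : Fin (r + 1))
    {P : SymDual K n} (hP : P.IsHomogeneous d) :
    pairing (scaledDual b p i).1 P =
      ∑ j, (coeffMatrix b p).adjugate i j * coeff (b j).1 P := by
  rw [coe_scaledDual, map_sum, LinearMap.sum_apply]
  refine Finset.sum_congr rfl fun j _ => ?_
  rw [map_smul, LinearMap.smul_apply, pairing_dualMonomial hd _ hP, smul_eq_mul]

theorem pairing_scaledDual_self (hd : ringChar K = 0 ∨ d < ringChar K)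
    (b : Fin (r + 1) ≃ Exponent n d) (p : Fin (r + 1) → Form K n d) (i j : Fin (r + 1)) :
    pairing (scaledDual b p i).1 (p j).1 = if i = j then basisDet b p else 0 := by
  rw [pairing_scaledDual hd b p i (p j).2]
  have := congrFun (congrFun (Matrix.adjugate_mul (coeffMatrix b p)) i) j
  rw [Matrix.mul_apply, Matrix.smul_apply, Matrix.one_apply, smul_eq_mul, mul_ite, mul_one,
    mul_zero] at this
  exact this

theorem apolar_scaledDual (hd : ringChar K = 0 ∨ d < ringChar K)
    (b : Fin (r + 1) ≃ Exponent n d) (p : Fin (r + 1) → Form K n d) (i j : Fin (r + 1)) :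
    apolar (scaledDual b p i).1 (p j).1 = C (if i = j then basisDet b p else 0) := by
  rw [apolar_eq_C (scaledDual b p i).2 (p j).2, pairing_scaledDual_self hd]

/-- `∑ Δpᵢ*(P) pᵢ = Δ P`. -/
theorem sum_pairing_scaledDual_smul (hd : ringChar K = 0 ∨ d < ringChar K)
    (b : Fin (r + 1) ≃ Exponent n d) (p : Fin (r + 1) → Form K n d) {P : SymDual K n}
    (hP : P.IsHomogeneous d) :
    ∑ i, pairing (scaledDual b p i).1 P • (p i).1 = basisDet b p • P := by
  refine ext_of_isHomogeneous (d := d) (IsHomogeneous.sum _ _ _ fun i _ =>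
    (homogeneousSubmodule _ _ d).smul_mem _ (p i).2)
    ((homogeneousSubmodule _ _ d).smul_mem _ hP) fun α => ?_
  obtain ⟨l, rfl⟩ := b.surjective α
  have h := congrArg (fun M => Matrix.mulVec M (fun j => coeff (b j).1 P) l)
    (Matrix.mul_adjugate (coeffMatrix b p))
  simp only [← Matrix.mulVec_mulVec, Matrix.smul_mulVec, Matrix.one_mulVec] at h
  simp only [coeff_sum, coeff_smul, pairing_scaledDual hd b p _ hP]
  simp only [smul_eq_mul]
  rw [show basisDet b p * coeff (b l).1 P = _ from h.symm]
  simp only [Matrix.mulVec, dotProduct]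
  exact Finset.sum_congr rfl fun i _ => mul_comm _ _

theorem eq_sum_pairing_smul_dualMonomial (hd : ringChar K = 0 ∨ d < ringChar K)
    (b : Fin (r + 1) ≃ Exponent n d) {p : SymPrimal K n} (hp : p.IsHomogeneous d) :
    p = ∑ j, pairing p (monomial (b j).1 1) • (dualMonomial (b j) : CoForm K n d).1 := by
  have h : ∀ α : Exponent n d, (pairing p (monomial α.1 1) : K) =
      coeff α.1 p * ∏ i, ((α.1 i).factorial : K) := by
    intro α
    conv_lhs => rw [eq_sum_coeff_smul b hp]
    obtain ⟨l, rfl⟩ := b.surjective α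
    simp only [map_sum, map_smul, LinearMap.sum_apply, LinearMap.smul_apply, smul_eq_mul]
    rw [Finset.sum_eq_single l]
    · rw [pairing_monomial (b l).2 (b l).2, if_pos rfl]; ring
    · intro j _ hj
      rw [pairing_monomial (b j).2 (b l).2, if_neg, mul_zero]
      exact fun e => hj (b.injective (Subtype.ext e))
    · simp
  refine ext_of_isHomogeneous hp (IsHomogeneous.sum _ _ _ fun j _ =>
    (homogeneousSubmodule _ _ d).smul_mem _ (dualMonomial (b j)).2) fun α => ?_
  obtain ⟨l, rfl⟩ := b.surjective α
  change _ = coeff _ (∑ j, _ • monomial (b j).1 _)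
  rw [coeff_sum_smul_monomial, h, mul_assoc,
    mul_inv_cancel₀ (prod_factorial_ne_zero hd (b l).2.le), mul_one]

/-- The adjugate reverses products, and the adjugate of a matrix of determinant 1 is its inverse. By
invariance of the pairing, the dual monomials transform by that same inverse matrix. -/
theorem scaledDual_actForm (hd : ringChar K = 0 ∨ d < ringChar K)
    (b : Fin (r + 1) ≃ Exponent n d) (A : GL (Fin (n + 1)) K) (hA : actDet b A = 1)
    (p : Fin (r + 1) → Form K n d) (i : Fin (r + 1)) :
    scaledDual b (fun i => actForm A (p i)) i = actCoForm A (scaledDual b p i) := by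
  have hadj : (actMatrix b A).adjugate = actMatrix b A⁻¹ := by
    calc _ = (actMatrix b A).adjugate * (actMatrix b A * actMatrix b A⁻¹) := by
          rw [← actMatrix_mul, mul_inv_cancel, actMatrix_one, mul_one]
      _ = _ := by
          rw [← mul_assoc, Matrix.adjugate_mul, show (actMatrix b A).det = 1 from hA, one_smul,
            one_mul]
  have hdual : ∀ j, actPrimal A (dualMonomial (b j) : CoForm K n d).1 =
      ∑ l, actMatrix b A⁻¹ j l • (dualMonomial (b l) : CoForm K n d).1 := by
    intro j
    rw [eq_sum_pairing_smul_dualMonomial hd b (isHomogeneous_actPrimal A (dualMonomial (b j)).2)]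
    refine Finset.sum_congr rfl fun l _ => ?_
    congr 1
    have h := pairing_act A (dualMonomial (b j) : CoForm K n d).1
      (actDual A⁻¹ (monomial (b l).1 1))
    rw [← actDual_mul, mul_inv_cancel, actDual_one] at h
    rw [h, pairing_dualMonomial hd _ (isHomogeneous_actDual _ (isHomogeneous_monomial _ (b l).2))]
    rfl
  refine Subtype.ext ?_
  change _ = actPrimal A (scaledDual b p i).1
  rw [coe_scaledDual, coe_scaledDual, coeffMatrix_actForm, Matrix.adjugate_mul_distrib, hadj]
  simp only [map_sum, map_smul, hdual, Matrix.mul_apply, Finset.smul_sum, Finset.sum_smul,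
    smul_smul]
  exact Finset.sum_comm

theorem linearIndependent_iff_basisDet_ne_zero (b : Fin (r + 1) ≃ Exponent n d)
    (p : Fin (r + 1) → Form K n d) : LinearIndependent K p ↔ basisDet b p ≠ 0 := by
  let e : Form K n d →ₗ[K] (Fin (r + 1) → K) :=
    { toFun := fun f j => coeff (b j).1 f.1
      map_add' := fun f g => by ext; simp
      map_smul' := fun c f => by ext; simp }
  have he : LinearMap.ker e = ⊥ := by
    refine LinearMap.ker_eq_bot'.mpr fun f hf => Subtype.ext ?_
    refine ext_of_isHomogeneous f.2 (isHomogeneous_zero _ _ _) fun α => ?_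
    obtain ⟨l, rfl⟩ := b.surjective α
    exact (congrFun hf l).trans (coeff_zero _).symm
  rw [← LinearMap.linearIndependent_iff e he, basisDet, ← isUnit_iff_ne_zero,
    ← Matrix.isUnit_iff_isUnit_det, ← Matrix.linearIndependent_cols_iff_isUnit]
  rfl

end DualBasis

/-! ### Calculus of homogeneous polynomial maps -/

section PolynomialMaps

variable {K : Type*} [Field K] {n m : ℕ}
variable {M N P : Type*} [AddCommGroup M] [Module K M] [AddCommGroup N] [Module K N]
  [AddCommGroup P] [Module K P]

theorem IsHomogeneousPolyFun.mul {e e' : ℕ} {F G : Form K n m → K}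
    (hF : IsHomogeneousPolyFun e F) (hG : IsHomogeneousPolyFun e' G) :
    IsHomogeneousPolyFun (e + e') fun f => F f * G f := by
  obtain ⟨p, hp, hp'⟩ := hF
  obtain ⟨q, hq, hq'⟩ := hG
  exact ⟨p * q, hp.mul hq, fun f => by simp only [map_mul, hp', hq']⟩

/-- The homogeneous polynomial functions of degree `e` on `Sym^m(W*)`. -/
def polyFun (K : Type*) [Field K] (n m e : ℕ) : Submodule K (Form K n m → K) where
  carrier := {F | IsHomogeneousPolyFun e F}
  zero_mem' := ⟨0, isHomogeneous_zero _ _ _, by simp⟩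
  add_mem' := by
    rintro F G ⟨p, hp, hp'⟩ ⟨q, hq, hq'⟩
    exact ⟨p + q, hp.add hq, fun f => by rw [map_add, Pi.add_apply, hp', hq']⟩
  smul_mem' := by
    rintro c F ⟨p, hp, hp'⟩
    refine ⟨c • p, (homogeneousSubmodule _ _ e).smul_mem c hp, fun f => ?_⟩
    rw [smul_eval, Pi.smul_apply, hp', smul_eq_mul]

theorem isHomogeneousPolyFun_const (c : K) :
    IsHomogeneousPolyFun 0 fun _ : Form K n m => c :=
  ⟨C c, isHomogeneous_C _ _, fun f => by simp⟩

theorem isHomogeneousPolyFun_coeff (α : Exponent n m) :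
    IsHomogeneousPolyFun 1 fun f : Form K n m => coeff α.1 f.1 :=
  ⟨X α, isHomogeneous_X _ _, fun f => by simp⟩

theorem IsHomogeneousPolyFun.prod {ι : Type*} (s : Finset ι) {e : ι → ℕ}
    {F : ι → Form K n m → K} (hF : ∀ i ∈ s, IsHomogeneousPolyFun (e i) (F i)) :
    IsHomogeneousPolyFun (∑ i ∈ s, e i) fun f => ∏ i ∈ s, F i f := by
  classical
  induction s using Finset.induction_on with
  | empty => simpa using isHomogeneousPolyFun_const 1
  | insert a s ha ih =>
    simp only [Finset.sum_insert ha, Finset.prod_insert ha]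
    exact (hF a (Finset.mem_insert_self a s)).mul
      (ih fun i hi => hF i (Finset.mem_insert_of_mem hi))

/-- Each term of the Leibniz expansion uses exactly one entry of every column, so the degree may
vary from column to column; this matters because the qᵢ can have different degrees. -/
theorem isHomogeneousPolyFun_det {ι : Type*} [Fintype ι] [DecidableEq ι] {e : ι → ℕ}
    {S : Form K n m → Matrix ι ι K}
    (hS : ∀ i j, IsHomogeneousPolyFun (e j) fun f => S f i j) :
    IsHomogeneousPolyFun (∑ j, e j) fun f => (S f).det := by
  simp only [Matrix.det_apply]
  have : (fun f => ∑ σ : Equiv.Perm ι, Equiv.Perm.sign σ • ∏ i, S f (σ i) i) =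
      ∑ σ : Equiv.Perm ι, (((Equiv.Perm.sign σ : ℤ) : K) • fun f => ∏ i, S f (σ i) i) := by
    funext f
    simp [Finset.sum_apply, Units.smul_def]
  rw [this]
  exact (polyFun K n m _).sum_mem fun σ _ => (polyFun K n m _).smul_mem _ <|
    IsHomogeneousPolyFun.prod _ fun i _ => hS _ _

/-- Homogeneous polynomial maps of degree `e` from `Sym^m(W*)` to a vector space. -/
def IsPolyMap (e : ℕ) (F : Form K n m → M) : Prop :=
  F ∈ Submodule.span K {G | ∃ φ, IsHomogeneousPolyFun e φ ∧ ∃ v : M, G = fun f => φ f • v}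

theorem IsHomogeneousPolyFun.smul_const {e : ℕ} {φ : Form K n m → K}
    (h : IsHomogeneousPolyFun e φ) (v : M) : IsPolyMap e fun f => φ f • v :=
  Submodule.subset_span ⟨φ, h, v, rfl⟩

theorem IsPolyMap.sum {ι : Type*} {s : Finset ι} {e : ℕ} {F : ι → Form K n m → M}
    (h : ∀ i ∈ s, IsPolyMap e (F i)) : IsPolyMap e fun f => ∑ i ∈ s, F i f := by
  have : (fun f => ∑ i ∈ s, F i f) = ∑ i ∈ s, F i := by funext f; simp
  rw [this]
  exact Submodule.sum_mem _ h

theorem isPolyMap_zero (e : ℕ) : IsPolyMap e fun _ : Form K n m => (0 : M) :=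
  Submodule.zero_mem _

theorem IsPolyMap.add {e : ℕ} {F G : Form K n m → M} (hF : IsPolyMap e F) (hG : IsPolyMap e G) :
    IsPolyMap e fun f => F f + G f := Submodule.add_mem _ hF hG

theorem IsPolyMap.smul {e : ℕ} {F : Form K n m → M} (c : K) (hF : IsPolyMap e F) :
    IsPolyMap e fun f => c • F f := Submodule.smul_mem _ c hF

theorem IsPolyMap.linear {e : ℕ} {F : Form K n m → M} (h : IsPolyMap e F) (L : M →ₗ[K] N) :
    IsPolyMap e fun f => L (F f) := by
  refine Submodule.span_induction (p := fun F _ => IsPolyMap e fun f => L (F f))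
    ?_ ?_ ?_ ?_ h
  · rintro _ ⟨φ, hφ, v, rfl⟩
    simpa only [map_smul] using hφ.smul_const (L v)
  · simpa only [Pi.zero_apply, map_zero] using isPolyMap_zero e
  · intro F G _ _ hF hG
    simpa only [Pi.add_apply, map_add] using hF.add hG
  · intro c F _ hF
    simpa only [Pi.smul_apply, map_smul] using hF.smul c

/-- Products, tensors, contractions and pairings are all bilinear, so this closure property gives
homogeneity, with an explicit degree, of every expression used below. -/
theorem IsPolyMap.bilinear {e e' : ℕ} {F : Form K n m → M} {G : Form K n m → N}
    (hF : IsPolyMap e F) (hG : IsPolyMap e' G) (B : M →ₗ[K] N →ₗ[K] P) :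
    IsPolyMap (e + e') fun f => B (F f) (G f) := by
  refine Submodule.span_induction (p := fun F _ => IsPolyMap (e + e') fun f => B (F f) (G f))
    ?_ ?_ ?_ ?_ hF
  · rintro _ ⟨φ, hφ, v, rfl⟩
    refine Submodule.span_induction
      (p := fun G _ => IsPolyMap (e + e') fun f => B (φ f • v) (G f)) ?_ ?_ ?_ ?_ hG
    · rintro _ ⟨ψ, hψ, w, rfl⟩
      simpa only [map_smul, LinearMap.smul_apply, smul_smul, mul_comm] using
        (hφ.mul hψ).smul_const (B v w)
    · simpa only [Pi.zero_apply, map_zero] using isPolyMap_zero _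
    · intro F G _ _ hF hG
      simpa only [Pi.add_apply, map_add] using hF.add hG
    · intro c F _ hF
      simpa only [Pi.smul_apply, map_smul (B _)] using hF.smul c
  · simpa only [Pi.zero_apply, map_zero, LinearMap.zero_apply] using isPolyMap_zero _
  · intro F G _ _ hF hG
    simpa only [Pi.add_apply, map_add, LinearMap.add_apply] using hF.add hG
  · intro c F _ hF
    simpa only [Pi.smul_apply, map_smul, LinearMap.smul_apply] using hF.smul c

theorem IsPolyMap.isHomogeneousPolyFun {e : ℕ} {F : Form K n m → K} (h : IsPolyMap e F) :
    IsHomogeneousPolyFun e F := by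
  refine (Submodule.span_le (p := polyFun K n m e)).mpr ?_ h
  rintro _ ⟨φ, hφ, v, rfl⟩
  have := (polyFun K n m e).smul_mem v hφ
  rwa [show v • φ = fun f => φ f • v from funext fun f => mul_comm _ _] at this

theorem isPolyMap_const (v : M) : IsPolyMap 0 fun _ : Form K n m => v := by
  simpa using (isHomogeneousPolyFun_const (n := n) (m := m) (1 : K)).smul_const v

theorem IsPolyMap.prod {R : Type*} [CommRing R] [Algebra K R] {ι : Type*} (s : Finset ι)
    {e : ι → ℕ} {F : ι → Form K n m → R} (hF : ∀ i ∈ s, IsPolyMap (e i) (F i)) :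
    IsPolyMap (∑ i ∈ s, e i) fun f => ∏ i ∈ s, F i f := by
  classical
  induction s using Finset.induction_on with
  | empty => simpa using isPolyMap_const (1 : R)
  | insert a s ha ih =>
    simp only [Finset.sum_insert ha, Finset.prod_insert ha]
    exact (hF a (Finset.mem_insert_self a s)).bilinear
      (ih fun i hi => hF i (Finset.mem_insert_of_mem hi)) (LinearMap.mul K R)

instance finite_exponent (n d : ℕ) : Finite (Exponent n d) :=
  ((Finsupp.finite_of_degree_le d).subset fun _ h => le_of_eq h).to_subtype

theorem isPolyMap_of_coeff {d e : ℕ} {c : Form K n m → Form K n d}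
    (h : ∀ β : Exponent n d, IsHomogeneousPolyFun e fun f => coeff β.1 (c f).1) :
    IsPolyMap e fun f => (c f).1 := by
  obtain ⟨N, ⟨b⟩⟩ := Finite.exists_equiv_fin (Exponent n d)
  have : (fun f => (c f).1) = fun f => ∑ j, coeff (b.symm j).1 (c f).1 •
      (monomial (b.symm j).1 1 : SymDual K n) := by
    funext f
    refine ext_of_isHomogeneous (c f).2 (IsHomogeneous.sum _ _ _ fun j _ => ?_) fun α => ?_
    · exact (homogeneousSubmodule _ _ d).smul_mem _ (isHomogeneous_monomial _ (b.symm j).2)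
    · obtain ⟨l, rfl⟩ := b.symm.surjective α
      rw [coeff_sum, Finset.sum_eq_single l]
      · simp
      · intro j _ hj
        have : (b.symm j).1 ≠ (b.symm l).1 := fun h => hj (b.symm.injective (Subtype.ext h))
        simp [coeff_monomial, this]
      · simp
  rw [this]
  exact IsPolyMap.sum fun j _ => (h _).smul_const _

theorem isPolyMap_coe : IsPolyMap 1 fun f : Form K n m => f.1 :=
  isPolyMap_of_coeff (c := id) isHomogeneousPolyFun_coeff

end PolynomialMaps

/-! ### Invariance of Δ, of f̃ and of the entries of M -/

section Invariants

variable {K : Type*} [Field K] {n d r m : ℕ}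

theorem isHomogeneousPolyFun_basisDet (b : Fin (r + 1) ≃ Exponent n d)
    {q : Fin (r + 1) → Form K n m → Form K n d} {e : Fin (r + 1) → ℕ}
    (h : ∀ i β, IsHomogeneousPolyFun (e i) fun f => coeff (β : Exponent n d).1 (q i f).1) :
    IsHomogeneousPolyFun (∑ i, e i) fun g => basisDet b fun i => q i g :=
  isHomogeneousPolyFun_det fun j i => h i (b j)

/-- By Cramer's rule an entry in row i of the adjugate is the determinant of S with column i
replaced by a constant vector; that column contributes degree 0, whence `Function.update e i 0`. -/
theorem isPolyMap_scaledDual (b : Fin (r + 1) ≃ Exponent n d)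
    {q : Fin (r + 1) → Form K n m → Form K n d} {e : Fin (r + 1) → ℕ}
    (h : ∀ i β, IsHomogeneousPolyFun (e i) fun f => coeff (β : Exponent n d).1 (q i f).1)
    (i : Fin (r + 1)) :
    IsPolyMap (∑ l, Function.update e i 0 l) fun g => (scaledDual b (fun i => q i g) i).1 := by
  simp only [coe_scaledDual]
  refine IsPolyMap.sum fun j _ => IsHomogeneousPolyFun.smul_const ?_ _
  have : ∀ g, (coeffMatrix b fun i => q i g).adjugate i j =
      ((coeffMatrix b fun i => q i g).updateCol i (Pi.single j 1)).det := fun g => by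
    rw [← Matrix.cramer_apply, Matrix.cramer_eq_adjugate_mulVec, Matrix.mulVec_single_one]; rfl
  simp only [this]
  refine isHomogeneousPolyFun_det fun l t => ?_
  by_cases ht : t = i
  · subst ht
    simp only [Matrix.updateCol_self, Function.update_self]
    exact isHomogeneousPolyFun_const _
  · simp only [Matrix.updateCol_ne ht, Function.update_of_ne ht]
    exact h t (b l)

theorem isHomogeneousPolyFun_coeff_of_isPolyMap {e : ℕ} {F : Form K n m → SymPrimal K n}
    (h : IsPolyMap e F) (β : Fin (n + 1) →₀ ℕ) : IsHomogeneousPolyFun e fun f => coeff β (F f) :=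
  (h.linear (lcoeff K β)).isHomogeneousPolyFun

theorem isHomogeneousPolyFun_tildeCoeff (b : Fin (r + 1) ≃ Exponent n d)
    {q : Fin (r + 1) → Form K n m → Form K n d} {e : Fin (r + 1) → ℕ}
    (h : ∀ i β, IsHomogeneousPolyFun (e i) fun f => coeff (β : Exponent n d).1 (q i f).1)
    {k : ℕ} (I : Fin k → Fin (r + 1)) :
    IsHomogeneousPolyFun (∑ t, ∑ l, Function.update e (I t) 0 l + 1) (tildeCoeff b q I) :=
  ((IsPolyMap.prod Finset.univ fun t _ => isPolyMap_scaledDual b h (I t)).bilinear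
    isPolyMap_coe pairing).isHomogeneousPolyFun

variable [Infinite K]

theorem isInvariant_basisDet (hn : 0 < n) (b : Fin (r + 1) ≃ Exponent n d)
    {q : Fin (r + 1) → Form K n m → Form K n d} (hq : ∀ i, IsCovariant (q i)) :
    IsInvariant fun g => basisDet b fun i => q i g := by
  choose e he using fun i => (hq i).1
  refine ⟨⟨_, isHomogeneousPolyFun_basisDet b he⟩, fun A f => ?_⟩
  simp only [(hq _).2 A f, basisDet_actForm, actDet_specialLinear b hn, one_mul]

theorem scaledDual_covariant (hn : 0 < n) (hd : ringChar K = 0 ∨ d < ringChar K)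
    (b : Fin (r + 1) ≃ Exponent n d)
    {q : Fin (r + 1) → Form K n m → Form K n d} (hq : ∀ i, IsCovariant (q i)) (i : Fin (r + 1))
    (A : Matrix.SpecialLinearGroup (Fin (n + 1)) K) (f : Form K n m) :
    scaledDual b (fun i => q i (actForm (A : GL (Fin (n + 1)) K) f)) i =
      actCoForm (A : GL (Fin (n + 1)) K) (scaledDual b (fun i => q i f) i) := by
  simp only [(hq _).2 A f, scaledDual_actForm hd b _ (actDet_specialLinear b hn A)]

theorem isContravariant_scaledDual (hn : 0 < n) (hd : ringChar K = 0 ∨ d < ringChar K)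
    (b : Fin (r + 1) ≃ Exponent n d)
    {q : Fin (r + 1) → Form K n m → Form K n d} (hq : ∀ i, IsCovariant (q i)) (i : Fin (r + 1)) :
    IsContravariant fun g => scaledDual b (fun i => q i g) i := by
  choose e he using fun i => (hq i).1
  exact ⟨⟨_, fun β => isHomogeneousPolyFun_coeff_of_isPolyMap (isPolyMap_scaledDual b he i) β.1⟩,
    scaledDual_covariant hn hd b hq i⟩

theorem tildeCoeff_actForm (hn : 0 < n) (hd : ringChar K = 0 ∨ d < ringChar K)
    (b : Fin (r + 1) ≃ Exponent n d)
    {q : Fin (r + 1) → Form K n m → Form K n d} (hq : ∀ i, IsCovariant (q i))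
    {k : ℕ} (I : Fin k → Fin (r + 1))
    (A : Matrix.SpecialLinearGroup (Fin (n + 1)) K) (f : Form K n m) :
    tildeCoeff b q I (actForm (A : GL (Fin (n + 1)) K) f) = tildeCoeff b q I f := by
  simp only [tildeCoeff, scaledDual_covariant hn hd b hq]
  have := pairing_act (A : GL (Fin (n + 1)) K)
    (∏ t, (scaledDual b (fun i => q i f) (I t)).1) f.1
  rw [map_prod] at this
  exact this

theorem isInvariant_tildeCoeff (hn : 0 < n) (hd : ringChar K = 0 ∨ d < ringChar K)
    (b : Fin (r + 1) ≃ Exponent n d)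
    {q : Fin (r + 1) → Form K n m → Form K n d} (hq : ∀ i, IsCovariant (q i))
    {k : ℕ} (I : Fin k → Fin (r + 1)) : IsInvariant (tildeCoeff b q I) := by
  choose e he using fun i => (hq i).1
  exact ⟨⟨_, isHomogeneousPolyFun_tildeCoeff b he I⟩, tildeCoeff_actForm hn hd b hq I⟩

/-- Several index tuples contribute to the same monomial. They have the same degree because it
depends only on how often each index occurs, that is, on γ; hence the sum is still homogeneous. -/
theorem isInvariant_coeff_tildeForm (hn : 0 < n) (hd : ringChar K = 0 ∨ d < ringChar K)
    (b : Fin (r + 1) ≃ Exponent n d)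
    {q : Fin (r + 1) → Form K n m → Form K n d} (hq : ∀ i, IsCovariant (q i)) (k : ℕ)
    (γ : Fin (r + 1) →₀ ℕ) : IsInvariant fun g => coeff γ (tildeForm k b q g) := by
  choose e he using fun i => (hq i).1
  refine ⟨⟨∑ i, γ i * ∑ l, Function.update e i 0 l + 1, ?_⟩, fun A f => ?_⟩
  · have hX : ∀ I : Fin k → Fin (r + 1),
        (∏ t, X (I t) : MvPolynomial (Fin (r + 1)) K) =
          monomial (∑ t, Finsupp.single (I t) 1) 1 := fun I => by
      rw [monomial_sum_one]; rfl
    have : (fun g => coeff γ (tildeForm k b q g)) = ∑ I : Fin k → Fin (r + 1),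
        if ∑ t, Finsupp.single (I t) 1 = γ then tildeCoeff b q I else 0 := by
      funext g
      rw [tildeForm, coeff_sum, Finset.sum_apply]
      refine Finset.sum_congr rfl fun I _ => ?_
      rw [hX, coeff_C_mul, coeff_monomial]
      split_ifs <;> simp
    rw [this]
    refine (polyFun K n m _).sum_mem fun I _ => ?_
    split_ifs with h
    · have := isHomogeneousPolyFun_tildeCoeff b he I
      change IsHomogeneousPolyFun _ _
      convert this using 2
      rw [← h]
      simp only [Finsupp.finsetSum_apply, Finset.sum_mul]
      rw [Finset.sum_comm]
      refine Finset.sum_congr rfl fun t _ => ?_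
      rw [Finset.sum_eq_single (I t)]
      · rw [Finsupp.single_eq_same, one_mul]
      · intro i _ hi; rw [Finsupp.single_eq_of_ne hi, zero_mul]
      · exact fun h => absurd (Finset.mem_univ _) h
    · exact (polyFun K n m _).zero_mem
  · simp only [tildeForm, tildeCoeff_actForm hn hd b hq]

theorem isInvariant_relationMatrix (hn : 0 < n) (hd : ringChar K = 0 ∨ d < ringChar K)
    (b : Fin (r + 1) ≃ Exponent n d)
    {q : Fin (r + 1) → Form K n m → Form K n d} (hq : ∀ i, IsCovariant (q i))
    (ij lm : Fin (r + 1) × Fin (r + 1)) : IsInvariant fun g => relationMatrix b q g ij lm := by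
  choose e he using fun i => (hq i).1
  refine ⟨⟨_, (((isPolyMap_scaledDual b he ij.1).bilinear (isPolyMap_scaledDual b he ij.2)
    (LinearMap.mul K _)).bilinear ((isPolyMap_of_coeff (he lm.1)).bilinear
    (isPolyMap_of_coeff (he lm.2)) (LinearMap.mul K _)) pairing).isHomogeneousPolyFun⟩,
    fun A f => ?_⟩
  have := pairing_act (A : GL (Fin (n + 1)) K) ((scaledDual b (fun i => q i f) ij.1).1 *
    (scaledDual b (fun i => q i f) ij.2).1) ((q lm.1 f).1 * (q lm.2 f).1)
  rw [map_mul (actPrimal _), map_mul (actDual _)] at this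
  simp only [relationMatrix, Matrix.of_apply, scaledDual_covariant hn hd b hq]
  simp only [(hq _).2 A f]
  exact this

end Invariants

/-! ### Equivariant contraction and exchange of tensors -/

section Contraction

open scoped TensorProduct

variable {K : Type*} [Field K] {n d : ℕ}

/-- The map `(c, P, a) ↦ ∑ⱼ D(∂c/∂wⱼ, P) ⊗ ∂a/∂xⱼ`. -/
def contraction : SymPrimal K n →ₗ[K] SymDual K n →ₗ[K] SymDual K n →ₗ[K]
    SymDual K n ⊗[K] SymDual K n :=
  ∑ j, ((apolar (K := K) (n := n)).comp
    ((pderiv j : Derivation K (SymPrimal K n) (SymPrimal K n)) :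
      SymPrimal K n →ₗ[K] SymPrimal K n)).compr₂
    ((TensorProduct.mk K (SymDual K n) (SymDual K n)).compl₂
      ((pderiv j : Derivation K (SymDual K n) (SymDual K n)) : SymDual K n →ₗ[K] SymDual K n))

theorem contraction_apply (c : SymPrimal K n) (P a : SymDual K n) :
    contraction c P a = ∑ j, apolar (pderiv j c) P ⊗ₜ[K] pderiv j a := by
  simp [contraction]

/-- The action of `A` on `Sym(W*) ⊗ Sym(W*)`. -/
abbrev actTensor (A : GL (Fin (n + 1)) K) :
    SymDual K n ⊗[K] SymDual K n →ₐ[K] SymDual K n ⊗[K] SymDual K n :=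
  Algebra.TensorProduct.map (actDual A) (actDual A)

theorem sum_tmul_sum_of_dual {ι M : Type*} [Fintype ι] [DecidableEq ι] [AddCommGroup M]
    [Module K M] {A B : ι → ι → K} (h : ∀ l j, ∑ i, B l i * A i j = if l = j then 1 else 0)
    (f g : ι → M) :
    ∑ i, (∑ j, A i j • f j) ⊗ₜ[K] (∑ l, B l i • g l) = ∑ j, f j ⊗ₜ[K] g j := by
  simp only [TensorProduct.sum_tmul, TensorProduct.tmul_sum, TensorProduct.smul_tmul_smul]
  rw [Finset.sum_comm]
  refine Finset.sum_congr rfl fun j _ => ?_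
  rw [Finset.sum_comm, Finset.sum_eq_single j]
  · rw [← Finset.sum_smul, Finset.sum_congr rfl fun i _ => mul_comm (A i j) (B j i), h j j,
      if_pos rfl, one_smul]
  · intro l _ hl
    rw [← Finset.sum_smul, Finset.sum_congr rfl fun i _ => mul_comm (A i l) (B j i), h j l,
      if_neg hl.symm, zero_smul]
  · exact fun h => absurd (Finset.mem_univ _) h

/-- The derivatives in w and in x transform by mutually inverse matrices, so the sum over j, being a
sum over dual bases, does not see A. -/
theorem contraction_act (A : GL (Fin (n + 1)) K) (c : SymPrimal K n) (P a : SymDual K n) :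
    contraction (actPrimal A c) (actDual A P) (actDual A a) = actTensor A (contraction c P a) := by
  simp only [contraction_apply, map_sum, pderiv_actPrimal, pderiv_actDual, LinearMap.sum_apply,
    apolar_mul_apply, apolar_C, apolar_act, Algebra.TensorProduct.map_tmul]
  simp only [← smul_eq_C_mul]
  exact sum_tmul_sum_of_dual (sum_inv_mul A) _ _

/-- The bilinear map with `(y ⊗ z, y' ⊗ z') ↦ yz ⊗ y'z' - y'z ⊗ yz'`. -/
def exchange : SymDual K n ⊗[K] SymDual K n →ₗ[K] SymDual K n ⊗[K] SymDual K n →ₗ[K]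
    SymDual K n ⊗[K] SymDual K n :=
  LinearMap.mk₂ K (fun s s' => LinearMap.mul' K (SymDual K n) s ⊗ₜ[K]
      LinearMap.mul' K (SymDual K n) s' -
        TensorProduct.comm K (SymDual K n) (SymDual K n)
          (s * TensorProduct.comm K (SymDual K n) (SymDual K n) s'))
    (fun s t s' => by simp only [map_add, TensorProduct.add_tmul, add_mul]; abel)
    (fun c s s' => by
      simp only [map_smul, TensorProduct.smul_tmul', smul_mul_assoc, smul_sub])
    (fun s s' t => by simp only [map_add, TensorProduct.tmul_add, mul_add]; abel)
    (fun c s s' => by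
      simp only [map_smul, TensorProduct.tmul_smul, mul_smul_comm, smul_sub])

/-- Both terms multiply out to y z y' z', so values of `exchange` lie in the kernel of
multiplication. For linear y, y' they are the elementary relations that swap one linear factor. -/
theorem exchange_tmul (y z y' z' : SymDual K n) :
    exchange (y ⊗ₜ[K] z) (y' ⊗ₜ[K] z') = (y * z) ⊗ₜ[K] (y' * z') - (y' * z) ⊗ₜ[K] (y * z') := by
  simp only [exchange, LinearMap.mk₂_apply, LinearMap.mul'_apply, TensorProduct.comm_tmul,
    Algebra.TensorProduct.tmul_mul_tmul, mul_comm z y']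

theorem exchange_act (A : GL (Fin (n + 1)) K) (s s' : SymDual K n ⊗[K] SymDual K n) :
    exchange (actTensor A s) (actTensor A s') = actTensor A (exchange s s') := by
  induction s using TensorProduct.induction_on with
  | zero => simp
  | add s t hs ht => simp only [map_add, LinearMap.add_apply, hs, ht]
  | tmul y z =>
    induction s' using TensorProduct.induction_on with
    | zero => simp
    | add s t hs ht => simp only [map_add, hs, ht]
    | tmul y' z' => simp only [Algebra.TensorProduct.map_tmul, exchange_tmul, map_sub, map_mul]

/-- The pairing of `Sym(W) ⊗ Sym(W)` with `Sym(W*) ⊗ Sym(W*)`. -/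
def tensorPairing : SymPrimal K n ⊗[K] SymPrimal K n →ₗ[K] SymDual K n ⊗[K] SymDual K n →ₗ[K] K :=
  (TensorProduct.map₂ pairing pairing).compr₂ (LinearMap.mul' K K)

theorem tensorPairing_tmul (u u' : SymPrimal K n) (y y' : SymDual K n) :
    tensorPairing (u ⊗ₜ[K] u') (y ⊗ₜ[K] y') = pairing u y * pairing u' y' := by
  simp [tensorPairing]

theorem tensorPairing_act (A : GL (Fin (n + 1)) K) (u u' : SymPrimal K n)
    (s : SymDual K n ⊗[K] SymDual K n) :
    tensorPairing (actPrimal A u ⊗ₜ[K] actPrimal A u') (actTensor A s) =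
      tensorPairing (u ⊗ₜ[K] u') s := by
  induction s using TensorProduct.induction_on with
  | zero => simp
  | add s t hs ht => simp only [map_add, hs, ht]
  | tmul y z => simp only [Algebra.TensorProduct.map_tmul, tensorPairing_tmul, pairing_act]

theorem descFactorial_ne_zero_of_lt_ringChar (hd : ringChar K = 0 ∨ d < ringChar K) {a k : ℕ}
    (hka : k ≤ a) (had : a ≤ d) : (a.descFactorial k : K) ≠ 0 := by
  have h := factorial_ne_zero_of_lt_ringChar (K := K) (m := a) (hd.imp id had.trans_lt)
  rw [← Nat.factorial_mul_descFactorial hka, Nat.cast_mul] at h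
  exact right_ne_zero_of_mul h

/-- The tensors xᵢ ⊗ x^m form a basis of W* ⊗ Sym^{d-1}(W*), so contractions span this space. The
scalar involves only integers between 1 and d, which are invertible in K. -/
theorem exists_contraction_eq (hd : ringChar K = 0 ∨ d < ringChar K) (i : Fin (n + 1))
    {m : Fin (n + 1) →₀ ℕ} (hm : m.degree + 1 = d) :
    ∃ (c : CoForm K n d) (P a : Form K n d) (s : K), s ≠ 0 ∧
      contraction c.1 P.1 a.1 = s • ((X i : SymDual K n) ⊗ₜ[K] (monomial m 1 : SymDual K n)) := by
  -- With c = w₀^d only j = 0 survives: ∂c/∂w₀ applied to P = x₀^{d-1}xᵢ leaves a multiple of xᵢ,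
  -- and ∂a/∂x₀ for a = x₀x^m is (m₀ + 1)x^m.
  refine ⟨⟨monomial (Finsupp.single 0 d) 1, isHomogeneous_monomial _ (by simp)⟩,
    ⟨monomial (Finsupp.single 0 (d - 1) + Finsupp.single i 1) 1,
      isHomogeneous_monomial _ (by simp only [map_add, Finsupp.degree_single]; omega)⟩,
    ⟨monomial (m + Finsupp.single 0 1) 1, isHomogeneous_monomial _ (by simp [hm])⟩,
    ((d : K) * ∏ l, (((Finsupp.single 0 (d - 1) + Finsupp.single i 1 : Fin (n + 1) →₀ ℕ)
      l).descFactorial ((Finsupp.single 0 (d - 1) : Fin (n + 1) →₀ ℕ) l) : K)) * (m 0 + 1 : ℕ),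
    ?_, ?_⟩
  · refine mul_ne_zero (mul_ne_zero ?_ (Finset.prod_ne_zero_iff.mpr fun l _ => ?_)) ?_
    · have := descFactorial_ne_zero_of_lt_ringChar (K := K) hd (a := d) (k := 1) (by omega) le_rfl
      rwa [Nat.descFactorial_one] at this
    · refine descFactorial_ne_zero_of_lt_ringChar hd (by simp) ?_
      refine (Finsupp.le_degree l _).trans ?_
      simp only [map_add, Finsupp.degree_single]
      omega
    · have h0 := Finsupp.le_degree 0 m
      have := descFactorial_ne_zero_of_lt_ringChar (K := K) hd (a := m 0 + 1) (k := 1)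
        (by omega) (by omega)
      rwa [Nat.descFactorial_one] at this
  · rw [contraction_apply, Finset.sum_eq_single 0]
    · simp only [pderiv_monomial, Finsupp.single_eq_same]
      rw [show (Finsupp.single 0 d - Finsupp.single 0 1 : Fin (n + 1) →₀ ℕ) =
        Finsupp.single 0 (d - 1) from Finsupp.single_tsub.symm, apolar_monomial,
        add_tsub_cancel_left, add_tsub_cancel_right, X, ← TensorProduct.smul_tmul_smul,
        smul_monomial, smul_monomial]
      simp
    · intro j _ hj
      simp [pderiv_monomial, Finsupp.single_eq_of_ne hj]
    · simp

end Contraction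

/-! ### Expansion in the scaled dual basis -/

section DualExpansion

variable {K : Type*} [Field K] {n d r : ℕ}

/-- `∑ D(c, pᵢ) Δpᵢ* = Δ c`. -/
theorem sum_pairing_smul_scaledDual (hd : ringChar K = 0 ∨ d < ringChar K)
    (b : Fin (r + 1) ≃ Exponent n d) (p : Fin (r + 1) → Form K n d) {c : SymPrimal K n}
    (hc : c.IsHomogeneous d) :
    ∑ i, pairing c (p i).1 • (scaledDual b p i).1 = basisDet b p • c := by
  have hl : (∑ i, pairing c (p i).1 • (scaledDual b p i).1).IsHomogeneous d :=
    IsHomogeneous.sum _ _ _ fun i _ =>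
      (homogeneousSubmodule _ _ d).smul_mem _ (scaledDual b p i).2
  have hr : (basisDet b p • c).IsHomogeneous d := (homogeneousSubmodule _ _ d).smul_mem _ hc
  rw [eq_sum_pairing_smul_dualMonomial hd b hl, eq_sum_pairing_smul_dualMonomial hd b hr]
  refine Finset.sum_congr rfl fun j _ => ?_
  congr 1
  have h := congrArg (pairing c) (sum_pairing_scaledDual_smul hd b p
    (isHomogeneous_monomial (R := K) (1 : K) (b j).2))
  simp only [map_sum, map_smul, LinearMap.sum_apply, LinearMap.smul_apply, smul_eq_mul] at h ⊢
  rw [← h]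
  exact Finset.sum_congr rfl fun i _ => mul_comm _ _

end DualExpansion

/-! ### Quadratic forms attached to tensors; exchanges of monomials -/

section Quadrics

open scoped TensorProduct

variable {K : Type*} [Field K] {n d r m : ℕ}

/-- The linear form `∑ᵢ D(Δpᵢ*, y) Xᵢ`. -/
def linearForm (b : Fin (r + 1) ≃ Exponent n d) (p : Fin (r + 1) → Form K n d) :
    SymDual K n →ₗ[K] MvPolynomial (Fin (r + 1)) K :=
  ∑ i, (LinearMap.toSpanSingleton K (MvPolynomial (Fin (r + 1)) K) (X i)).comp
    (pairing (scaledDual b p i).1)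

theorem linearForm_apply (b : Fin (r + 1) ≃ Exponent n d) (p : Fin (r + 1) → Form K n d)
    (y : SymDual K n) : linearForm b p y = ∑ i, pairing (scaledDual b p i).1 y • X i := by
  simp [linearForm]

/-- The quadratic form attached to a tensor, with `y ⊗ y'` giving the product of the linear
forms of `y` and `y'`. -/
def tensorQuadric (b : Fin (r + 1) ≃ Exponent n d) (p : Fin (r + 1) → Form K n d) :
    SymDual K n ⊗[K] SymDual K n →ₗ[K] MvPolynomial (Fin (r + 1)) K :=
  (LinearMap.mul' K _).comp (TensorProduct.map (linearForm b p) (linearForm b p))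

theorem tensorQuadric_tmul (b : Fin (r + 1) ≃ Exponent n d) (p : Fin (r + 1) → Form K n d)
    (y y' : SymDual K n) :
    tensorQuadric b p (y ⊗ₜ[K] y') = linearForm b p y * linearForm b p y' := by
  simp [tensorQuadric]

theorem tensorQuadric_eq_quadric (b : Fin (r + 1) ≃ Exponent n d) (p : Fin (r + 1) → Form K n d)
    (s : SymDual K n ⊗[K] SymDual K n) :
    tensorQuadric b p s = quadric fun lm =>
      tensorPairing ((scaledDual b p lm.1).1 ⊗ₜ[K] (scaledDual b p lm.2).1) s := by
  induction s using TensorProduct.induction_on with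
  | zero => simp [quadric]
  | add s t hs ht =>
    rw [map_add, hs, ht]
    simp only [quadric, map_add, add_mul, Finset.sum_add_distrib]
  | tmul y z =>
    rw [tensorQuadric_tmul, linearForm_apply, linearForm_apply, Finset.sum_mul_sum, quadric,
      Fintype.sum_prod_type]
    refine Finset.sum_congr rfl fun i _ => Finset.sum_congr rfl fun j _ => ?_
    rw [tensorPairing_tmul, smul_mul_smul_comm, smul_eq_C_mul]

theorem linearForm_self (hd : ringChar K = 0 ∨ d < ringChar K)
    (b : Fin (r + 1) ≃ Exponent n d) (p : Fin (r + 1) → Form K n d) (j : Fin (r + 1)) :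
    linearForm b p (p j).1 = basisDet b p • X j := by
  rw [linearForm_apply, Finset.sum_eq_single j]
  · rw [pairing_scaledDual_self hd, if_pos rfl]
  · intro i _ hi; rw [pairing_scaledDual_self hd, if_neg hi, zero_smul]
  · simp

/-- Up to Δ, `linearForm` inverts the substitution Xᵢ ↦ pᵢ, so relations among forms of degree d can
be transported to the Xᵢ. -/
theorem aeval_linearForm (hd : ringChar K = 0 ∨ d < ringChar K)
    (b : Fin (r + 1) ≃ Exponent n d) (p : Fin (r + 1) → Form K n d) {y : SymDual K n}
    (hy : y.IsHomogeneous d) :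
    aeval (fun i => (p i).1) (linearForm b p y) = basisDet b p • y := by
  rw [linearForm_apply, map_sum, ← sum_pairing_scaledDual_smul hd b p hy]
  simp only [map_smul, aeval_X]

theorem isHomogeneous_linearForm (b : Fin (r + 1) ≃ Exponent n d) (p : Fin (r + 1) → Form K n d)
    (y : SymDual K n) : (linearForm b p y).IsHomogeneous 1 := by
  rw [linearForm_apply]
  exact IsHomogeneous.sum _ _ _ fun i _ =>
    (homogeneousSubmodule _ _ 1).smul_mem _ (isHomogeneous_X _ i)

theorem isHomogeneous_quadric (c : Fin (r + 1) × Fin (r + 1) → K) :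
    (quadric c).IsHomogeneous 2 :=
  IsHomogeneous.sum _ _ _ fun lm _ => by
    rw [← smul_eq_C_mul]
    exact (homogeneousSubmodule _ _ 2).smul_mem _
      ((isHomogeneous_X _ lm.1).mul (isHomogeneous_X _ lm.2))

theorem exists_eq_quadric {P : MvPolynomial (Fin (r + 1)) K} (hP : P.IsHomogeneous 2) :
    ∃ c, P = quadric c := by
  let q : (Fin (r + 1) × Fin (r + 1) → K) →ₗ[K] MvPolynomial (Fin (r + 1)) K :=
    { toFun := quadric
      map_add' := fun c c' => by
        simp only [quadric, Pi.add_apply, map_add, add_mul, Finset.sum_add_distrib]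
      map_smul' := fun a c => by
        simp only [quadric, Pi.smul_apply, smul_eq_mul, map_mul, mul_assoc, ← Finset.mul_sum,
          smul_eq_C_mul, RingHom.id_apply] }
  suffices P ∈ LinearMap.range q by
    obtain ⟨c, hc⟩ := this
    exact ⟨c, hc.symm⟩
  rw [P.as_sum]
  refine Submodule.sum_mem _ fun α hα => ?_
  have hdeg : α.degree = 2 := by
    rw [Finsupp.degree_eq_weight_one]; exact hP (mem_support_iff.mp hα)
  have hex : ∀ β : Fin (r + 1) →₀ ℕ, 0 < β.degree → ∃ l, Finsupp.single l 1 ≤ β := by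
    intro β hβ
    obtain ⟨l, hl⟩ : ∃ l, β l ≠ 0 := by
      by_contra! h
      rw [show β = 0 from Finsupp.ext h, map_zero] at hβ
      exact lt_irrefl _ hβ
    exact ⟨l, Finsupp.single_le_iff.mpr (Nat.one_le_iff_ne_zero.mpr hl)⟩
  obtain ⟨l, hl⟩ := hex α (by omega)
  have h1 := tsub_add_cancel_of_le hl
  have hdeg1 : (α - Finsupp.single l 1).degree = 1 := by
    have := congrArg Finsupp.degree h1
    rw [map_add, Finsupp.degree_single] at this
    omega
  obtain ⟨l', hl'⟩ := hex (α - Finsupp.single l 1) (by omega)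
  have h2 := tsub_add_cancel_of_le hl'
  have hdeg2 : (α - Finsupp.single l 1 - Finsupp.single l' 1).degree = 0 := by
    have := congrArg Finsupp.degree h2
    rw [map_add, Finsupp.degree_single] at this
    omega
  rw [Finsupp.degree_eq_zero_iff] at hdeg2
  refine ⟨Pi.single (l', l) (coeff α P), ?_⟩
  change quadric _ = _
  rw [quadric, Finset.sum_eq_single (l', l)]
  · rw [Pi.single_eq_same, X, X, monomial_mul, C_mul_monomial, mul_one, mul_one]
    congr 1
    rw [← h1, ← h2, hdeg2, zero_add]
  · intro lm _ hlm
    rw [Pi.single_eq_of_ne hlm, C_0, zero_mul]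
  · simp

/-- Two pairs of monomials of degree `d` with the same product are linked by exchanges of one
variable. -/
theorem eq_of_exchange {ι M : Type*} (F : (ι →₀ ℕ) → (ι →₀ ℕ) → M)
    (hF : ∀ i j μ ν, μ.degree + 1 = d → ν.degree + 1 = d →
      F (μ + Finsupp.single i 1) (ν + Finsupp.single j 1) =
        F (μ + Finsupp.single j 1) (ν + Finsupp.single i 1))
    {β γ β' γ' : ι →₀ ℕ} (hβ : β.degree = d) (hγ : γ.degree = d) (hβ' : β'.degree = d)
    (h : β + γ = β' + γ') : F β γ = F β' γ' := by
  induction hN : (β - β').degree using Nat.strong_induction_on generalizing β γ with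
  | _ N ih =>
    subst hN
    by_cases hle : β ≤ β'
    · have h1 := congrArg Finsupp.degree (tsub_add_cancel_of_le hle)
      rw [map_add, hβ, hβ'] at h1
      have h0 : (β' - β).degree = 0 := by omega
      rw [Finsupp.degree_eq_zero_iff, tsub_eq_zero_iff_le] at h0
      obtain rfl := le_antisymm hle h0
      rw [add_left_cancel h]
    -- The variable i is too frequent in β and j too rare. Exchanging i in β with j in γ keeps the
    -- product and lowers the degree of `β - β'` by one.
    · obtain ⟨i, hi⟩ : ∃ i, β' i < β i := by
        by_contra! hc; exact hle hc
      obtain ⟨j, hj⟩ : ∃ j, β j < β' j := by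
        by_contra! hc
        have h1 := congrArg Finsupp.degree (tsub_add_cancel_of_le (show β' ≤ β from hc))
        rw [map_add, hβ, hβ'] at h1
        have h0 : (β - β').degree = 0 := by omega
        rw [Finsupp.degree_eq_zero_iff, tsub_eq_zero_iff_le] at h0
        exact hle h0
      have hij : i ≠ j := by rintro rfl; omega
      have hγj : 0 < γ j := by
        have := DFunLike.congr_fun h j
        simp only [Finsupp.add_apply] at this
        omega
      have e1 : β - Finsupp.single i 1 + Finsupp.single i 1 = β :=
        tsub_add_cancel_of_le (Finsupp.single_le_iff.mpr (show 1 ≤ β i by omega))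
      have e2 : γ - Finsupp.single j 1 + Finsupp.single j 1 = γ :=
        tsub_add_cancel_of_le (Finsupp.single_le_iff.mpr hγj)
      set μ := β - Finsupp.single i 1
      set ν := γ - Finsupp.single j 1
      have d1 : μ.degree + 1 = d := by rw [← hβ, ← e1, map_add, Finsupp.degree_single]
      have d2 : ν.degree + 1 = d := by rw [← hγ, ← e2, map_add, Finsupp.degree_single]
      have key := hF i j μ ν d1 d2
      rw [e1, e2] at key
      rw [key]
      refine ih _ ?_ (by rw [map_add, Finsupp.degree_single, d1])
        (by rw [map_add, Finsupp.degree_single, d2]) ?_ rfl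
      · have hlt : μ + Finsupp.single j 1 - β' + Finsupp.single i 1 = β - β' := by
          ext l
          rw [← e1]
          simp only [Finsupp.add_apply, Finsupp.tsub_apply]
          by_cases hl : l = i
          · subst hl
            have : β l = μ l + 1 := by rw [← e1]; simp
            rw [Finsupp.single_eq_same, Finsupp.single_eq_of_ne hij]
            omega
          · by_cases hl' : l = j
            · subst hl'
              have : β l = μ l := by rw [← e1]; simp [Finsupp.single_eq_of_ne hl]
              rw [Finsupp.single_eq_same, Finsupp.single_eq_of_ne hl]
              omega
            · rw [Finsupp.single_eq_of_ne hl, Finsupp.single_eq_of_ne hl', add_zero, add_zero]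
        rw [← hlt, map_add, Finsupp.degree_single]
        omega
      · rw [← h, ← e1, ← e2]
        abel

end Quadrics

/-! ### All quadratic relations, with invariant coefficients -/

section Relations

open scoped TensorProduct

variable {K : Type*} [Field K] {n d r m : ℕ}

/-- An element of the kernel of `Sym^d(W*) ⊗ Sym^d(W*) → Sym^{2d}(W*)` attached to six indices. -/
def relationTensor (b : Fin (r + 1) ≃ Exponent n d) (p : Fin (r + 1) → Form K n d)
    (t : Fin 6 → Fin (r + 1)) : SymDual K n ⊗[K] SymDual K n :=
  exchange (contraction (scaledDual b p (t 0)).1 (p (t 1)).1 (p (t 2)).1)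
    (contraction (scaledDual b p (t 3)).1 (p (t 4)).1 (p (t 5)).1)

/-- The coefficients of the quadratic form defined by `relationTensor`. -/
def relationCoeff (b : Fin (r + 1) ≃ Exponent n d) (q : Fin (r + 1) → Form K n m → Form K n d)
    (t : Fin 6 → Fin (r + 1)) (lm : Fin (r + 1) × Fin (r + 1)) (g : Form K n m) : K :=
  tensorPairing ((scaledDual b (fun i => q i g) lm.1).1 ⊗ₜ[K]
    (scaledDual b (fun i => q i g) lm.2).1) (relationTensor b (fun i => q i g) t)

theorem IsPolyMap.contraction {e e' e'' : ℕ} {c : Form K n m → SymPrimal K n}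
    {P a : Form K n m → SymDual K n} (hc : IsPolyMap e c) (hP : IsPolyMap e' P)
    (ha : IsPolyMap e'' a) :
    IsPolyMap (e + e' + e'') fun f =>
      HypersurfaceReconstruction.contraction (c f) (P f) (a f) := by
  simp only [contraction_apply]
  exact IsPolyMap.sum fun j _ => ((hc.linear (pderiv j : Derivation K _ _).toLinearMap).bilinear hP
    apolar).bilinear (ha.linear (pderiv j : Derivation K _ _).toLinearMap) (TensorProduct.mk K _ _)

theorem isInvariant_relationCoeff [Infinite K] (hn : 0 < n) (hd : ringChar K = 0 ∨ d < ringChar K)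
    (b : Fin (r + 1) ≃ Exponent n d)
    {q : Fin (r + 1) → Form K n m → Form K n d} (hq : ∀ i, IsCovariant (q i))
    (t : Fin 6 → Fin (r + 1)) (lm : Fin (r + 1) × Fin (r + 1)) :
    IsInvariant (relationCoeff b q t lm) := by
  choose e he using fun i => (hq i).1
  have hs := isPolyMap_scaledDual b he
  have hp := fun i => isPolyMap_of_coeff (he i)
  refine ⟨⟨_, (((hs lm.1).bilinear (hs lm.2) (TensorProduct.mk K _ _)).bilinear
    ((IsPolyMap.contraction (hs (t 0)) (hp (t 1)) (hp (t 2))).bilinear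
      (IsPolyMap.contraction (hs (t 3)) (hp (t 4)) (hp (t 5))) exchange)
    tensorPairing).isHomogeneousPolyFun⟩, fun A f => ?_⟩
  have h := tensorPairing_act (A : GL (Fin (n + 1)) K) (scaledDual b (fun i => q i f) lm.1).1
    (scaledDual b (fun i => q i f) lm.2).1 (relationTensor b (fun i => q i f) t)
  rw [relationTensor, ← exchange_act, ← contraction_act, ← contraction_act] at h
  simp only [relationCoeff, relationTensor, scaledDual_covariant hn hd b hq]
  simp only [(hq _).2 A f]
  exact h

/-- The span of the quadratic forms defined by the tensors `relationTensor`. -/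
def relationSpan (b : Fin (r + 1) ≃ Exponent n d) (p : Fin (r + 1) → Form K n d) :
    Submodule K (MvPolynomial (Fin (r + 1)) K) :=
  Submodule.span K (Set.range fun t => tensorQuadric b p (relationTensor b p t))

/-- Substituting the pᵢ turns either half of the exchange into Δ² y z y' z'. -/
theorem aeval_tensorQuadric_exchange (hd : ringChar K = 0 ∨ d < ringChar K)
    (b : Fin (r + 1) ≃ Exponent n d) (p : Fin (r + 1) → Form K n d) {y z y' z' : SymDual K n}
    {a : ℕ} (had : 1 + a = d) (hy : y.IsHomogeneous 1) (hz : z.IsHomogeneous a)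
    (hy' : y'.IsHomogeneous 1) (hz' : z'.IsHomogeneous a) :
    aeval (fun i => (p i).1) (tensorQuadric b p (exchange (y ⊗ₜ[K] z) (y' ⊗ₜ[K] z'))) = 0 := by
  subst had
  rw [exchange_tmul, map_sub, tensorQuadric_tmul, tensorQuadric_tmul, map_sub, map_mul (aeval _), map_mul (aeval _),
    aeval_linearForm hd b p (hy.mul hz), aeval_linearForm hd b p (hy'.mul hz'),
    aeval_linearForm hd b p (hy'.mul hz), aeval_linearForm hd b p (hy.mul hz')]
  simp only [smul_mul_smul_comm]
  rw [← smul_sub, sub_eq_zero.mpr (by ring), smul_zero]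

theorem aeval_tensorQuadric_relationTensor (hd0 : 0 < d) (hd : ringChar K = 0 ∨ d < ringChar K)
    (b : Fin (r + 1) ≃ Exponent n d) (p : Fin (r + 1) → Form K n d) (t : Fin 6 → Fin (r + 1)) :
    aeval (fun i => (p i).1) (tensorQuadric b p (relationTensor b p t)) = 0 := by
  have had : 1 + (d - 1) = d := by omega
  have h1 : ∀ i j l, (apolar (pderiv j (scaledDual b p i).1) (p l).1).IsHomogeneous 1 := by
    intro i j l
    have hpl : ∀ e, d = e → (p l).1.IsHomogeneous e := by
      rintro _ rfl; exact (p l).2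
    exact (IsHomogeneous.pderiv (scaledDual b p i).2).apolar (hpl _ (by omega))
  have h2 : ∀ j l, (pderiv j (p l).1).IsHomogeneous (d - 1) := fun j l =>
    IsHomogeneous.pderiv (p l).2
  simp only [relationTensor, contraction_apply, map_sum, LinearMap.sum_apply]
  exact Finset.sum_eq_zero fun j _ => Finset.sum_eq_zero fun j' _ =>
    aeval_tensorQuadric_exchange hd b p had (h1 _ _ _) (h2 _ _) (h1 _ _ _) (h2 _ _)

/-- Where Δ ≠ 0 the arguments c, P, a can be expanded in turn in the Δpᵢ* and the pᵢ, at the cost of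
a factor Δ each time. So the finitely many contractions of basis elements lose nothing. -/
theorem contraction_mem_span (hd : ringChar K = 0 ∨ d < ringChar K)
    (b : Fin (r + 1) ≃ Exponent n d) (p : Fin (r + 1) → Form K n d) (hp : basisDet b p ≠ 0)
    (c : CoForm K n d) (P a : Form K n d) :
    contraction c.1 P.1 a.1 ∈ Submodule.span K (Set.range fun t : Fin 3 → Fin (r + 1) =>
      contraction (scaledDual b p (t 0)).1 (p (t 1)).1 (p (t 2)).1) := by
  rw [← Submodule.smul_mem_iff _ hp, ← LinearMap.smul_apply, ← LinearMap.smul_apply, ← map_smul,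
    ← sum_pairing_smul_scaledDual hd b p c.2]
  simp only [map_sum, map_smul, LinearMap.sum_apply, LinearMap.smul_apply]
  refine Submodule.sum_mem _ fun i _ => Submodule.smul_mem _ _ ?_
  rw [← Submodule.smul_mem_iff _ hp, ← LinearMap.smul_apply, ← map_smul,
    ← sum_pairing_scaledDual_smul hd b p P.2]
  simp only [map_sum, map_smul, LinearMap.sum_apply, LinearMap.smul_apply]
  refine Submodule.sum_mem _ fun j _ => Submodule.smul_mem _ _ ?_
  rw [← Submodule.smul_mem_iff _ hp, ← map_smul, ← sum_pairing_scaledDual_smul hd b p a.2]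
  simp only [map_sum, map_smul]
  refine Submodule.sum_mem _ fun l _ => Submodule.smul_mem _ _ ?_
  exact Submodule.subset_span ⟨![i, j, l], rfl⟩

theorem tensorQuadric_exchange_mem (b : Fin (r + 1) ≃ Exponent n d)
    (p : Fin (r + 1) → Form K n d) {s s' : SymDual K n ⊗[K] SymDual K n}
    (hs : s ∈ Submodule.span K (Set.range fun t : Fin 3 → Fin (r + 1) =>
      contraction (scaledDual b p (t 0)).1 (p (t 1)).1 (p (t 2)).1))
    (hs' : s' ∈ Submodule.span K (Set.range fun t : Fin 3 → Fin (r + 1) =>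
      contraction (scaledDual b p (t 0)).1 (p (t 1)).1 (p (t 2)).1)) :
    tensorQuadric b p (exchange s s') ∈ relationSpan b p := by
  have h := Submodule.apply_mem_map₂ (exchange.compr₂ (tensorQuadric b p)) hs hs'
  rw [Submodule.map₂_span_span] at h
  refine Submodule.span_le.mpr ?_ h
  rintro _ ⟨_, ⟨t, rfl⟩, _, ⟨t', rfl⟩, rfl⟩
  exact Submodule.subset_span ⟨![t 0, t 1, t 2, t' 0, t' 1, t' 2], rfl⟩

/-- The difference is the exchange of xᵢ ⊗ x^μ with xⱼ ⊗ x^ν, and both tensors are contractions up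
to nonzero scalars. -/
theorem tensorQuadric_swap_mem (hd : ringChar K = 0 ∨ d < ringChar K)
    (b : Fin (r + 1) ≃ Exponent n d) (p : Fin (r + 1) → Form K n d) (hp : basisDet b p ≠ 0)
    (i j : Fin (n + 1)) {μ ν : Fin (n + 1) →₀ ℕ} (hμ : μ.degree + 1 = d)
    (hν : ν.degree + 1 = d) :
    tensorQuadric b p ((X i * monomial μ 1) ⊗ₜ[K] (X j * monomial ν 1)) -
      tensorQuadric b p ((X j * monomial μ 1) ⊗ₜ[K] (X i * monomial ν 1)) ∈
        relationSpan b p := by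
  obtain ⟨c, P, a, s, hs, h⟩ := exists_contraction_eq (K := K) hd i hμ
  obtain ⟨c', P', a', s', hs', h'⟩ := exists_contraction_eq (K := K) hd j hν
  have key := tensorQuadric_exchange_mem b p (contraction_mem_span hd b p hp c P a)
    (contraction_mem_span hd b p hp c' P' a')
  rw [h, h'] at key
  simp only [map_smul, LinearMap.smul_apply, Submodule.smul_mem_iff _ hs',
    Submodule.smul_mem_iff _ hs, exchange_tmul, map_sub] at key
  exact key

/-- Modulo `relationSpan`, the quadratic form of `y ⊗ y'` depends only on `y y'`. -/
theorem exists_factor_relationSpan (hd : ringChar K = 0 ∨ d < ringChar K)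
    (b : Fin (r + 1) ≃ Exponent n d) (p : Fin (r + 1) → Form K n d) (hp : basisDet b p ≠ 0) :
    ∃ φ : SymDual K n →ₗ[K] MvPolynomial (Fin (r + 1)) K ⧸ relationSpan b p,
      ∀ y y' : Form K n d, (relationSpan b p).mkQ (tensorQuadric b p (y.1 ⊗ₜ[K] y'.1)) =
        φ (y.1 * y'.1) := by
  classical
  let F : (Fin (n + 1) →₀ ℕ) → (Fin (n + 1) →₀ ℕ) →
      MvPolynomial (Fin (r + 1)) K ⧸ relationSpan b p := fun β γ =>
    (relationSpan b p).mkQ (tensorQuadric b p (monomial β 1 ⊗ₜ[K] monomial γ 1))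
  have hX : ∀ (μ : Fin (n + 1) →₀ ℕ) i, monomial (μ + Finsupp.single i 1) (1 : K) =
      X i * monomial μ 1 := fun μ i => by
    rw [X, monomial_mul, one_mul, add_comm μ]
  have hF := @eq_of_exchange d (Fin (n + 1)) _ F fun i j μ ν hμ hν => by
    simp only [F, hX]
    rw [← sub_eq_zero, ← map_sub, Submodule.mkQ_apply, Submodule.Quotient.mk_eq_zero]
    exact tensorQuadric_swap_mem hd b p hp i j hμ hν
  -- Any splitting of δ into two exponents of degree d serves, since F takes the same value on all
  -- of them; the value 0 at exponents without a splitting is never used.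
  let h : (Fin (n + 1) →₀ ℕ) → MvPolynomial (Fin (r + 1)) K ⧸ relationSpan b p := fun δ =>
    if hδ : ∃ βγ : Exponent n d × Exponent n d, βγ.1.1 + βγ.2.1 = δ then
      F hδ.choose.1.1 hδ.choose.2.1 else 0
  have hh : ∀ β γ : Exponent n d, h (β.1 + γ.1) = F β.1 γ.1 := by
    intro β γ
    have hex : ∃ βγ : Exponent n d × Exponent n d, βγ.1.1 + βγ.2.1 = β.1 + γ.1 := ⟨(β, γ), rfl⟩
    simp only [h, dif_pos hex]
    exact hF hex.choose.1.2 hex.choose.2.2 β.2 hex.choose_spec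
  refine ⟨(basisMonomials (Fin (n + 1)) K).constr K h, fun y y' => ?_⟩
  have hφ : ∀ β γ : Exponent n d, (basisMonomials (Fin (n + 1)) K).constr K h
      (monomial β.1 1 * monomial γ.1 1) = F β.1 γ.1 := by
    intro β γ
    rw [monomial_mul, one_mul, ← hh]
    have := (basisMonomials (Fin (n + 1)) K).constr_basis K h (β.1 + γ.1)
    rwa [coe_basisMonomials] at this
  rw [eq_sum_coeff_smul b y.2, eq_sum_coeff_smul b y'.2]
  simp only [TensorProduct.sum_tmul, TensorProduct.tmul_sum, TensorProduct.smul_tmul_smul,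
    Finset.sum_mul_sum, smul_mul_smul_comm, map_sum, map_smul, hφ]
  exact Finset.sum_comm

/-- Δ² times a quadric is the quadric of ∑ c_{lm} pₗ ⊗ pₘ. Modulo the span it depends only on ∑
c_{lm} pₗpₘ, which vanishes for a relation. -/
theorem mem_relationSpan_iff (hd0 : 0 < d) (hd : ringChar K = 0 ∨ d < ringChar K)
    (b : Fin (r + 1) ≃ Exponent n d) (p : Fin (r + 1) → Form K n d) (hp : basisDet b p ≠ 0)
    {P : MvPolynomial (Fin (r + 1)) K} (hP : P.IsHomogeneous 2) :
    aeval (fun i => (p i).1) P = 0 ↔ P ∈ relationSpan b p := by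
  constructor
  · intro h
    obtain ⟨c, rfl⟩ := exists_eq_quadric hP
    obtain ⟨φ, hφ⟩ := exists_factor_relationSpan hd b p hp
    have hE : (basisDet b p * basisDet b p) • quadric c =
        ∑ lm, c lm • tensorQuadric b p ((p lm.1).1 ⊗ₜ[K] (p lm.2).1) := by
      rw [quadric, Finset.smul_sum]
      refine Finset.sum_congr rfl fun lm _ => ?_
      rw [tensorQuadric_tmul, linearForm_self hd, linearForm_self hd, smul_mul_smul_comm,
        ← smul_eq_C_mul, smul_comm]
    rw [← Submodule.smul_mem_iff _ (mul_ne_zero hp hp), hE, ← Submodule.Quotient.mk_eq_zero,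
      ← Submodule.mkQ_apply, map_sum]
    simp only [map_smul, hφ]
    rw [quadric] at h
    simp only [map_sum, map_mul, aeval_C, aeval_X, algebraMap_eq] at h
    simp only [← smul_eq_C_mul] at h
    simp only [← map_smul, ← map_sum]
    rw [h, map_zero]
  · intro h
    refine (Submodule.span_le (p := LinearMap.ker
      (aeval fun i => (p i).1 : MvPolynomial (Fin (r + 1)) K →ₐ[K] _).toLinearMap)).mpr ?_ h
    rintro _ ⟨t, rfl⟩
    exact aeval_tensorQuadric_relationTensor hd0 hd b p t

end Relations

/-! ### Quadrics cut out the Veronese variety -/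

section Veronese

variable {K : Type*} [Field K] {n d r m : ℕ}

/-- The Veronese variety is cut out by the quadratic relations between monomials. -/
theorem exists_eq_veronese (hd : 0 < d) (Y : (Fin (n + 1) →₀ ℕ) → K)
    (hY : ∀ β γ β' γ' : Fin (n + 1) →₀ ℕ, β.degree = d → γ.degree = d → β'.degree = d →
      γ'.degree = d → β + γ = β' + γ' → Y β * Y γ = Y β' * Y γ')
    (h0 : ∃ β, β.degree = d ∧ Y β ≠ 0) :
    ∃ (v : Fin (n + 1) → K) (c : K), v ≠ 0 ∧ c ≠ 0 ∧ ∀ β : Fin (n + 1) →₀ ℕ, β.degree = d →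
      ∏ i, v i ^ β i = c * Y β := by
  obtain ⟨i, hi⟩ : ∃ i, Y (Finsupp.single i d) ≠ 0 := by
    obtain ⟨β, hβ, hYβ⟩ := h0
    obtain ⟨i, hi⟩ : ∃ i, β i ≠ 0 := by
      by_contra! h
      rw [show β = 0 from Finsupp.ext h, map_zero] at hβ
      omega
    refine ⟨i, ?_⟩
    induction hN : d - β i generalizing β with
    | zero =>
      have hle : Finsupp.single i d ≤ β := Finsupp.single_le_iff.mpr (by omega)
      have h1 := congrArg Finsupp.degree (tsub_add_cancel_of_le hle)
      rw [map_add, hβ, Finsupp.degree_single] at h1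
      have h2 : (β - Finsupp.single i d).degree = 0 := by omega
      rw [Finsupp.degree_eq_zero_iff, tsub_eq_zero_iff_le] at h2
      rwa [← le_antisymm h2 hle]
    | succ N ih =>
      obtain ⟨j, hj, hji⟩ : ∃ j, β j ≠ 0 ∧ j ≠ i := by
        by_contra! h
        have h1 : β = Finsupp.single i (β i) := by
          ext l
          by_cases hl : l = i
          · subst hl; simp
          · rw [Finsupp.single_eq_of_ne hl]
            by_contra hne
            exact hl (h l hne)
        rw [h1, Finsupp.degree_single] at hβ
        omega
      have hei : β - Finsupp.single i 1 + Finsupp.single i 1 = β :=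
        tsub_add_cancel_of_le (Finsupp.single_le_iff.mpr (Nat.one_le_iff_ne_zero.mpr hi))
      have hej : β - Finsupp.single j 1 + Finsupp.single j 1 = β :=
        tsub_add_cancel_of_le (Finsupp.single_le_iff.mpr (Nat.one_le_iff_ne_zero.mpr hj))
      have di := congrArg Finsupp.degree hei
      have dj := congrArg Finsupp.degree hej
      rw [map_add, Finsupp.degree_single, hβ] at di dj
      -- The square of Y at β is the product of its values at two neighbours, so the neighbour with
      -- one more i also has a nonzero value. Repeating this reaches the pure power of xᵢ.
      have key := hY β β (β - Finsupp.single i 1 + Finsupp.single j 1)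
        (β - Finsupp.single j 1 + Finsupp.single i 1) hβ hβ
        (by rw [map_add, Finsupp.degree_single, di]) (by rw [map_add, Finsupp.degree_single, dj])
        (calc β + β = (β - Finsupp.single i 1 + Finsupp.single i 1) +
              (β - Finsupp.single j 1 + Finsupp.single j 1) := by rw [hei, hej]
          _ = _ := by
            rw [add_add_add_comm, add_comm (Finsupp.single i 1), add_add_add_comm])
      have hne : Y (β - Finsupp.single j 1 + Finsupp.single i 1) ≠ 0 := fun h => by
        rw [h, mul_zero] at key
        exact hYβ (mul_self_eq_zero.mp key)
      have hval : (β - Finsupp.single j 1 + Finsupp.single i 1 : Fin (n + 1) →₀ ℕ) i =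
          β i + 1 := by
        rw [Finsupp.add_apply, Finsupp.tsub_apply, Finsupp.single_eq_same,
          Finsupp.single_eq_of_ne hji.symm, tsub_zero]
      refine ih _ (by rw [map_add, Finsupp.degree_single, dj]) hne (by omega) (by omega)
  -- On the chart where the coordinate of xᵢ^d is nonzero, the coordinates of xᵢ^{d-1}xⱼ recover the
  -- point up to a scalar; comparing β = d·eᵢ gives the constant c used next.
  let v : Fin (n + 1) → K := fun j => Y (Finsupp.single i (d - 1) + Finsupp.single j 1)
  have hvi : v i = Y (Finsupp.single i d) := by
    simp only [v, ← Finsupp.single_add]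
    rw [Nat.sub_add_cancel hd]
  refine ⟨v, Y (Finsupp.single i d) ^ (d - 1), fun h => hi (by rw [← hvi, h]; rfl),
    pow_ne_zero _ hi, fun β hβ => ?_⟩
  induction hN : d - β i generalizing β with
  | zero =>
    have hle : Finsupp.single i d ≤ β := Finsupp.single_le_iff.mpr (by omega)
    have h1 := congrArg Finsupp.degree (tsub_add_cancel_of_le hle)
    rw [map_add, hβ, Finsupp.degree_single] at h1
    have h2 : (β - Finsupp.single i d).degree = 0 := by omega
    rw [Finsupp.degree_eq_zero_iff, tsub_eq_zero_iff_le] at h2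
    rw [← le_antisymm hle h2, Finset.prod_eq_single i, Finsupp.single_eq_same, hvi, ← pow_succ,
      Nat.sub_add_cancel hd]
    · intro j _ hj; rw [Finsupp.single_eq_of_ne hj, pow_zero]
    · simp
  | succ N ih =>
    obtain ⟨j, hj, hji⟩ : ∃ j, β j ≠ 0 ∧ j ≠ i := by
      by_contra! h
      have h1 : β = Finsupp.single i (β i) := by
        ext l
        by_cases hl : l = i
        · subst hl; simp
        · rw [Finsupp.single_eq_of_ne hl]
          by_contra hne
          exact hl (h l hne)
      rw [h1, Finsupp.degree_single] at hβ
      omega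
    have hej : β - Finsupp.single j 1 + Finsupp.single j 1 = β :=
      tsub_add_cancel_of_le (Finsupp.single_le_iff.mpr (Nat.one_le_iff_ne_zero.mpr hj))
    set β₀ := β - Finsupp.single j 1
    have dj := congrArg Finsupp.degree hej
    rw [map_add, Finsupp.degree_single, hβ] at dj
    have hval : (β₀ + Finsupp.single i 1 : Fin (n + 1) →₀ ℕ) i = β i + 1 := by
      rw [← hej]
      simp [Finsupp.single_eq_of_ne hji.symm]
    have hprod : ∀ l, ∏ t, v t ^ (β₀ + Finsupp.single l 1 : Fin (n + 1) →₀ ℕ) t =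
        (∏ t, v t ^ β₀ t) * v l := by
      intro l
      simp only [Finsupp.add_apply, pow_add, Finset.prod_mul_distrib]
      rw [Finset.prod_eq_single (s := Finset.univ)
        (f := fun t => v t ^ (Finsupp.single l 1 : Fin (n + 1) →₀ ℕ) t) l]
      · simp
      · intro t _ ht; rw [Finsupp.single_eq_of_ne ht, pow_zero]
      · simp
    have hrec := ih (β₀ + Finsupp.single i 1) (by rw [map_add, Finsupp.degree_single, dj])
      (by omega)
    have key := hY β (Finsupp.single i d) (β₀ + Finsupp.single i 1)
      (Finsupp.single i (d - 1) + Finsupp.single j 1) hβ (by simp)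
      (by rw [map_add, Finsupp.degree_single, dj])
      (by rw [map_add, Finsupp.degree_single, Finsupp.degree_single]; omega)
      (by
        rw [← hej, show (Finsupp.single i d : Fin (n + 1) →₀ ℕ) =
          Finsupp.single i (d - 1) + Finsupp.single i 1 by
            rw [← Finsupp.single_add, Nat.sub_add_cancel hd]]
        abel)
    rw [hprod, hvi] at hrec
    rw [← hej, hprod, hej]
    refine mul_right_cancel₀ hi ?_
    calc _ = (∏ t, v t ^ β₀ t) * Y (Finsupp.single i d) * v j := by ring
      _ = Y (Finsupp.single i d) ^ (d - 1) * (Y (β₀ + Finsupp.single i 1) * v j) := by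
        rw [hrec]; ring
      _ = _ := by
        rw [show v j = Y (Finsupp.single i (d - 1) + Finsupp.single j 1) from rfl, ← key]
        ring

theorem eval_smul_of_isHomogeneous {σ : Type*} {e : ℕ} {Q : MvPolynomial σ K}
    (hQ : Q.IsHomogeneous e) (a : K) (w : σ → K) : eval (a • w) Q = a ^ e * eval w Q := by
  rw [eval_eq, eval_eq, Finset.mul_sum]
  refine Finset.sum_congr rfl fun α hα => ?_
  have hd : α.degree = e := by
    rw [Finsupp.degree_eq_weight_one]; exact hQ (mem_support_iff.mp hα)
  simp only [Pi.smul_apply, smul_eq_mul, mul_pow, Finset.prod_mul_distrib]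
  rw [Finset.prod_pow_eq_pow_sum, show ∑ i ∈ α.support, α i = e from hd]
  ring

theorem eval_aeval {σ τ : Type*} (g : σ → MvPolynomial τ K) (v : τ → K) (P : MvPolynomial σ K) :
    eval v (aeval g P) = eval (fun i => eval v (g i)) P := by
  induction P using MvPolynomial.induction_on with
  | C a => simp
  | add p q hp hq => rw [map_add, map_add, map_add, hp, hq]
  | mul_X p i hp => rw [map_mul, map_mul, map_mul, hp, aeval_X, eval_X]

theorem eval_monomial_one (v : Fin (n + 1) → K) (β : Fin (n + 1) →₀ ℕ) :
    eval v (monomial β 1) = ∏ i, v i ^ β i := by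
  rw [eval_monomial, one_mul, Finsupp.prod_fintype _ _ fun i => pow_zero _]

/-- A common zero of the pᵢ would be a zero of every form of degree d, in particular of every xⱼ^d.
-/
theorem basePointFree_of_basisDet_ne_zero (b : Fin (r + 1) ≃ Exponent n d)
    (hd : ringChar K = 0 ∨ d < ringChar K)
    (p : Fin (r + 1) → Form K n d) (hp : basisDet b p ≠ 0) : BasePointFree p := by
  intro v hv h
  obtain ⟨j, hj⟩ := Function.ne_iff.mp hv
  have hX : (X j ^ d : SymDual K n).IsHomogeneous d := by
    simpa using (isHomogeneous_X K j).pow d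
  have := congrArg (eval v) (sum_pairing_scaledDual_smul hd b p hX)
  rw [map_sum, smul_eval, map_pow, eval_X, Finset.sum_eq_zero] at this
  · exact mul_ne_zero hp (pow_ne_zero d hj) this.symm
  · intro i _
    rw [smul_eval, show eval v (p i).1 = 0 from congrFun h i, mul_zero]

/-- At a common zero y of the quadrics, the values of the linear forms attached to the monomials
satisfy all Veronese relations. They are therefore proportional to the monomials in some v, and v
maps to y. -/
theorem zeroLocus_eq_range_projMap (hd0 : 0 < d) (hd : ringChar K = 0 ∨ d < ringChar K)
    (b : Fin (r + 1) ≃ Exponent n d) (p : Fin (r + 1) → Form K n d) (hp : basisDet b p ≠ 0)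
    (hφ : BasePointFree p) {S : Set (MvPolynomial (Fin (r + 1)) K)}
    (hS : ∀ Q ∈ S, Q.IsHomogeneous 2 ∧ aeval (fun i => (p i).1) Q = 0)
    (hS' : ∀ P : MvPolynomial (Fin (r + 1)) K, P.IsHomogeneous 2 →
      aeval (fun i => (p i).1) P = 0 → P ∈ Submodule.span K S) :
    zeroLocus S = Set.range (projMap p hφ) := by
  apply Set.Subset.antisymm
  · intro y hy
    have hvan : ∀ P : MvPolynomial (Fin (r + 1)) K, P.IsHomogeneous 2 →
        aeval (fun i => (p i).1) P = 0 → eval y.rep P = 0 := by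
      intro P h1 h2
      refine Submodule.span_induction (p := fun P _ => eval y.rep P = 0) (fun Q hQ => hy Q hQ)
        (map_zero _) (fun P Q _ _ h h' => by rw [map_add, h, h', add_zero])
        (fun c P _ h => by rw [smul_eval, h, mul_zero]) (hS' P h1 h2)
    let Y : (Fin (n + 1) →₀ ℕ) → K := fun β => eval y.rep (linearForm b p (monomial β 1))
    have hsum : ∀ i, ∑ j, coeff (b j).1 (p i).1 * Y (b j).1 = basisDet b p * y.rep i := by
      intro i
      have h := congrArg (eval y.rep) (linearForm_self hd b p i)
      rw [eq_sum_coeff_smul b (p i).2] at h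
      simpa only [map_sum, map_smul, smul_eval, eval_X] using h
    obtain ⟨v, c, hv, hc, hvc⟩ := exists_eq_veronese hd0 Y (by
      intro β γ β' γ' h1 h2 h3 h4 h
      rw [← sub_eq_zero]
      simp only [Y, ← map_mul, ← map_sub]
      refine hvan _ (((isHomogeneous_linearForm b p _).mul (isHomogeneous_linearForm b p _)).sub
        ((isHomogeneous_linearForm b p _).mul (isHomogeneous_linearForm b p _))) ?_
      rw [map_sub, map_mul, map_mul, aeval_linearForm hd b p (isHomogeneous_monomial _ h1),
        aeval_linearForm hd b p (isHomogeneous_monomial _ h2),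
        aeval_linearForm hd b p (isHomogeneous_monomial _ h3),
        aeval_linearForm hd b p (isHomogeneous_monomial _ h4), smul_mul_smul_comm,
        smul_mul_smul_comm, monomial_mul, monomial_mul, h, sub_self]) (by
      by_contra! h
      refine y.rep_nonzero (funext fun i => ?_)
      have := hsum i
      rw [Finset.sum_eq_zero fun j _ => by rw [h _ (b j).2, mul_zero]] at this
      exact (mul_eq_zero.mp this.symm).resolve_left hp)
    refine ⟨Projectivization.mk K v hv, ?_⟩
    rw [projMap_mk]
    conv_rhs => rw [← y.mk_rep]
    rw [Projectivization.mk_eq_mk_iff']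
    refine ⟨c * basisDet b p, funext fun i => ?_⟩
    rw [Pi.smul_apply, smul_eq_mul, mul_assoc, ← hsum]
    conv_rhs => rw [eq_sum_coeff_smul b (p i).2]
    rw [map_sum, Finset.mul_sum]
    refine Finset.sum_congr rfl fun j _ => ?_
    rw [smul_eval, eval_monomial_one, hvc _ (b j).2]
    ring
  · rintro _ ⟨x, rfl⟩ Q hQ
    obtain ⟨h2, h0⟩ := hS Q hQ
    obtain ⟨a, ha⟩ := Projectivization.exists_smul_eq_mk_rep K _ (hφ x.rep x.rep_nonzero)
    rw [projMap, ← ha, Units.smul_def, eval_smul_of_isHomogeneous h2,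
      ← eval_aeval (fun i => (p i).1), h0, map_zero, mul_zero]

end Veronese

/-! ### The kernel of the matrix M -/

section RelationMatrix

variable {K : Type*} [Field K] {n d r m : ℕ}

/-- Where Δ ≠ 0 the Δpᵢ* span Sym^d(W), and every monomial of degree 2d is a product of two of
degree d, so H pairs to zero with each w^δ. That pairing is δ! times a coefficient, and δ! is
invertible by the bound on 2d. -/
theorem eq_zero_of_pairing_eq_zero (hd : ringChar K = 0 ∨ d < ringChar K)
    (hd2 : ringChar K = 0 ∨ 2 * d < ringChar K) (b : Fin (r + 1) ≃ Exponent n d)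
    (p : Fin (r + 1) → Form K n d) (hp : basisDet b p ≠ 0) {H : SymDual K n}
    (hH : H.IsHomogeneous (2 * d))
    (h : ∀ i j, pairing ((scaledDual b p i).1 * (scaledDual b p j).1) H = 0) : H = 0 := by
  have key : ∀ c c' : CoForm K n d, pairing (c.1 * c'.1) H = 0 := by
    intro c c'
    have h1 : pairing ((basisDet b p • c.1) * (basisDet b p • c'.1)) H = 0 := by
      rw [← sum_pairing_smul_scaledDual hd b p c.2, ← sum_pairing_smul_scaledDual hd b p c'.2,
        Finset.sum_mul_sum]
      simp only [map_sum, LinearMap.sum_apply, smul_mul_smul_comm, map_smul, LinearMap.smul_apply,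
        h, smul_zero, Finset.sum_const_zero]
    rw [smul_mul_smul_comm, map_smul, LinearMap.smul_apply, smul_eq_mul] at h1
    exact (mul_eq_zero.mp h1).resolve_left (mul_ne_zero hp hp)
  refine ext_of_isHomogeneous hH (isHomogeneous_zero _ _ _) fun δ => ?_
  obtain ⟨β, hβ, hβd⟩ := Finsupp.exists_le_degree_eq δ.1 d (by have := δ.2; omega)
  have hsum := add_tsub_cancel_of_le hβ
  have hγ : (δ.1 - β).degree = d := by
    have := congrArg Finsupp.degree hsum
    rw [map_add, δ.2] at this
    omega
  have h1 := key ⟨monomial β 1, isHomogeneous_monomial _ hβd⟩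
    ⟨monomial (δ.1 - β) 1, isHomogeneous_monomial _ hγ⟩
  rw [monomial_mul, hsum, pairing_monomial_right δ.2 _ hH, mul_one, one_mul] at h1
  rw [coeff_zero]
  exact (mul_eq_zero.mp h1).resolve_left (prod_factorial_ne_zero hd2 δ.2.le)

theorem aeval_quadric (p : Fin (r + 1) → Form K n d) (c : Fin (r + 1) × Fin (r + 1) → K) :
    aeval (fun i => (p i).1) (quadric c) = ∑ lm, c lm • ((p lm.1).1 * (p lm.2).1) := by
  simp only [quadric, map_sum, map_mul, aeval_C, aeval_X, algebraMap_eq, smul_eq_C_mul]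

theorem relationMatrix_mulVec_eq_zero_iff (hd : ringChar K = 0 ∨ d < ringChar K)
    (hd2 : ringChar K = 0 ∨ 2 * d < ringChar K) (b : Fin (r + 1) ≃ Exponent n d)
    (q : Fin (r + 1) → Form K n m → Form K n d) (f : Form K n m)
    (hf : basisDet b (fun i => q i f) ≠ 0) (c : Fin (r + 1) × Fin (r + 1) → K) :
    (relationMatrix b q f).mulVec c = 0 ↔ aeval (fun i => (q i f).1) (quadric c) = 0 := by
  have hM : ∀ ij, (relationMatrix b q f).mulVec c ij =
      pairing ((scaledDual b (fun i => q i f) ij.1).1 * (scaledDual b (fun i => q i f) ij.2).1)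
        (aeval (fun i => (q i f).1) (quadric c)) := by
    intro ij
    rw [aeval_quadric fun i => q i f, map_sum]
    refine Finset.sum_congr rfl fun lm _ => ?_
    rw [map_smul, smul_eq_mul, mul_comm]
    rfl
  constructor
  · intro h
    refine eq_zero_of_pairing_eq_zero hd hd2 b _ hf ?_ fun i j =>
      (hM (i, j)).symm.trans (congrFun h (i, j))
    rw [aeval_quadric fun i => q i f]
    refine IsHomogeneous.sum _ _ _ fun lm _ => (homogeneousSubmodule _ _ _).smul_mem _ ?_
    rw [two_mul]
    exact IsHomogeneous.mul (q lm.1 f).2 (q lm.2 f).2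
  · intro h
    funext ij
    rw [hM, h, map_zero, Pi.zero_apply]

end RelationMatrix

/-! ### Substituting the qᵢ(f) into f̃ returns a multiple of f -/

section Reconstruction

open scoped TensorProduct

variable {K : Type*} [Field K] {n d r m k : ℕ}

/-- `∑ Δpᵢ* ⊗ pᵢ` is, up to `Δ`, independent of the basis. -/
theorem sum_scaledDual_tmul (hd : ringChar K = 0 ∨ d < ringChar K)
    (b : Fin (r + 1) ≃ Exponent n d) (p : Fin (r + 1) → Form K n d) :
    ∑ i, (scaledDual b p i).1 ⊗ₜ[K] (p i).1 =
      basisDet b p • ∑ j, (dualMonomial (b j) : CoForm K n d).1 ⊗ₜ[K]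
        (monomial (b j).1 1 : SymDual K n) := by
  simp only [Finset.smul_sum, ← TensorProduct.tmul_smul,
    ← sum_pairing_scaledDual_smul hd b p (isHomogeneous_monomial (R := K) (1 : K) (b _).2),
    TensorProduct.tmul_sum]
  rw [Finset.sum_comm]
  refine Finset.sum_congr rfl fun i _ => ?_
  conv_lhs => rw [eq_sum_pairing_smul_dualMonomial hd b (scaledDual b p i).2]
  simp only [TensorProduct.tmul_smul, TensorProduct.sum_tmul, TensorProduct.smul_tmul']

theorem prod_tmul {A B ι : Type*} [CommRing A] [Algebra K A] [CommRing B] [Algebra K B]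
    (s : Finset ι) (x : ι → A) (y : ι → B) :
    ∏ i ∈ s, (x i ⊗ₜ[K] y i) = (∏ i ∈ s, x i) ⊗ₜ[K] (∏ i ∈ s, y i) := by
  classical
  induction s using Finset.induction_on with
  | empty => simp [Algebra.TensorProduct.one_def]
  | insert a s ha ih =>
    rw [Finset.prod_insert ha, Finset.prod_insert ha, Finset.prod_insert ha, ih,
      Algebra.TensorProduct.tmul_mul_tmul]

/-- The linear map `c ⊗ P ↦ D(c, f) P`. -/
def evalTensor (f : SymDual K n) : SymPrimal K n ⊗[K] SymDual K n →ₗ[K] SymDual K n :=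
  TensorProduct.lift ((LinearMap.lsmul K (SymDual K n)).comp (pairing.flip f))

theorem evalTensor_tmul (f : SymDual K n) (c : SymPrimal K n) (P : SymDual K n) :
    evalTensor f (c ⊗ₜ[K] P) = pairing c f • P := by
  simp [evalTensor]

theorem aeval_tildeForm {B : Type*} [CommRing B] [Algebra K B] (b : Fin (r + 1) ≃ Exponent n d)
    (q : Fin (r + 1) → Form K n m → Form K n d) (f : Form K n m) (x : Fin (r + 1) → B) :
    aeval x (tildeForm k b q f) =
      ∑ I : Fin k → Fin (r + 1), tildeCoeff b q I f • ∏ t, x (I t) := by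
  simp only [tildeForm, map_sum, map_mul, aeval_C, map_prod, aeval_X, Algebra.smul_def]

theorem factorial_mul_coeff_sum_X_pow {N : ℕ} {δ : Fin (n + 1) →₀ ℕ} (hδ : δ.degree = N) :
    (∏ i, ((δ i).factorial : K)) * coeff δ ((∑ i, X i : MvPolynomial (Fin (n + 1)) K) ^ N) =
      (N.factorial : K) := by
  have hsum : δ.sum (fun _ m => m) = N := hδ
  rw [coeff_sum_X_pow_of_fintype, if_pos hsum, Finsupp.multinomial_eq,
    ← Finset.prod_subset (Finset.subset_univ δ.support) fun i _ hi => by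
      rw [Finsupp.notMem_support_iff.mp hi, Nat.factorial_zero, Nat.cast_one],
    ← Nat.cast_prod, ← Nat.cast_mul, Nat.multinomial_spec, ← hsum]
  rfl

theorem sum_monomial_inv_factorial (hd : ringChar K = 0 ∨ d < ringChar K)
    (b : Fin (r + 1) ≃ Exponent n d) :
    ∑ j, (dualMonomial (b j) : CoForm K n d).1 =
      ((d.factorial : K)⁻¹) • (∑ i, X i : MvPolynomial (Fin (n + 1)) K) ^ d := by
  have hs : ((∑ i, X i : MvPolynomial (Fin (n + 1)) K) ^ d).IsHomogeneous d := by
    simpa using (IsHomogeneous.sum _ _ _ fun i _ => isHomogeneous_X K i).pow d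
  refine ext_of_isHomogeneous (IsHomogeneous.sum _ _ _ fun j _ => (dualMonomial (b j)).2)
    ((homogeneousSubmodule _ _ d).smul_mem _ hs) fun α => ?_
  obtain ⟨l, rfl⟩ := b.surjective α
  have h1 := coeff_sum_smul_monomial b (fun _ => (1 : K))
    (fun j => (∏ i, (((b j).1 i).factorial : K))⁻¹) l
  simp only [one_smul, one_mul] at h1
  refine h1.trans ?_
  have h2 := factorial_mul_coeff_sum_X_pow (K := K) (b l).2
  have hne := prod_factorial_ne_zero hd (b l).2.le
  have hd' := factorial_ne_zero_of_lt_ringChar hd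
  rw [coeff_smul, smul_eq_mul, inv_eq_iff_eq_inv, mul_inv, inv_inv]
  refine mul_right_cancel₀ (right_ne_zero_of_mul (h2.symm ▸ hd')) (h2.trans ?_)
  rw [mul_assoc, inv_mul_cancel₀ (right_ne_zero_of_mul (h2.symm ▸ hd')), mul_one]

/-- The canonical tensor is a divided-power version of exp(⟨w, x⟩), so its k-th power reproduces
forms of degree kd. The pairing gives a factor δ!, which the multinomial coefficient cancels. -/
theorem evalTensor_pow (hd : ringChar K = 0 ∨ d < ringChar K)
    (b : Fin (r + 1) ≃ Exponent n d) (f : Form K n (k * d)) :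
    evalTensor f.1 ((∑ j, (dualMonomial (b j) : CoForm K n d).1 ⊗ₜ[K]
        (monomial (b j).1 1 : SymDual K n)) ^ k) =
      (((k * d).factorial : K) * ((d.factorial : K)⁻¹) ^ k) • f.1 := by
  have hdeg : ∀ I : Fin k → Fin (r + 1), (∑ t, (b (I t)).1).degree = k * d := by
    intro I
    rw [map_sum, Finset.sum_congr rfl fun t _ => (b (I t)).2]
    simp
  have hdual : ∀ I : Fin k → Fin (r + 1), ∏ t, (dualMonomial (b (I t)) : CoForm K n d).1 =
      monomial (∑ t, (b (I t)).1) (∏ t, (∏ i, (((b (I t)).1 i).factorial : K))⁻¹) := by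
    intro I
    rw [monomial_sum_prod]
    rfl
  have hmon : ∀ I : Fin k → Fin (r + 1), ∏ t, (monomial (b (I t)).1 1 : SymDual K n) =
      monomial (∑ t, (b (I t)).1) 1 := by
    intro I
    rw [monomial_sum_one]
  rw [Fintype.sum_pow, map_sum]
  simp only [prod_tmul, evalTensor_tmul, hdual, hmon, pairing_monomial_right (hdeg _) _ f.2]
  refine ext_of_isHomogeneous (IsHomogeneous.sum _ _ _ fun I _ =>
    (homogeneousSubmodule _ _ _).smul_mem _ (isHomogeneous_monomial _ (hdeg I)))
    ((homogeneousSubmodule _ _ _).smul_mem _ f.2) fun δ => ?_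
  -- The sum of the products of 1/α! over all ways to write δ as an ordered sum of k exponents of
  -- degree d is the coefficient of x^δ in ((∑ xᵢ)^d/d!)^k.
  have hE : ∑ I : Fin k → Fin (r + 1), (if ∑ t, (b (I t)).1 = δ.1 then
      ∏ t, (∏ i, (((b (I t)).1 i).factorial : K))⁻¹ else 0) =
      ((d.factorial : K)⁻¹) ^ k *
        coeff δ.1 ((∑ i, X i : MvPolynomial (Fin (n + 1)) K) ^ (k * d)) := by
    have hs : ((d.factorial : K)⁻¹) ^ k * coeff δ.1
        (((∑ i, X i : MvPolynomial (Fin (n + 1)) K) ^ d) ^ k) = coeff δ.1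
        (((d.factorial : K)⁻¹ • (∑ i, X i : MvPolynomial (Fin (n + 1)) K) ^ d) ^ k) := by
      rw [smul_pow, coeff_smul, smul_eq_mul]
    rw [pow_mul', hs, ← sum_monomial_inv_factorial hd b, Fintype.sum_pow]
    simp only [hdual, coeff_sum, coeff_monomial]
  simp only [coeff_sum, coeff_smul, coeff_monomial, smul_eq_mul, mul_ite, mul_one, mul_zero]
  have hterm : ∀ I : Fin k → Fin (r + 1), (if ∑ t, (b (I t)).1 = δ.1 then
      (∏ t, (∏ i, (((b (I t)).1 i).factorial : K))⁻¹) *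
        (∏ i, (((∑ t, (b (I t)).1 : Fin (n + 1) →₀ ℕ) i).factorial : K)) *
          coeff (∑ t, (b (I t)).1) f.1 else 0) =
      (if ∑ t, (b (I t)).1 = δ.1 then
        ∏ t, (∏ i, (((b (I t)).1 i).factorial : K))⁻¹ else 0) *
        ((∏ i, ((δ.1 i).factorial : K)) * coeff δ.1 f.1) := by
    intro I
    split_ifs with h
    · rw [h, mul_assoc]
    · rw [zero_mul]
  rw [Finset.sum_congr rfl fun I _ => hterm I, ← Finset.sum_mul, hE,
    ← factorial_mul_coeff_sum_X_pow (K := K) δ.2]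
  ring

/-- `f̃(q₀(f), …, qᵣ(f))` is a multiple of `f`. -/
theorem aeval_tildeForm_self (hd : ringChar K = 0 ∨ d < ringChar K) (b : Fin (r + 1) ≃ Exponent n d)
    (q : Fin (r + 1) → Form K n (k * d) → Form K n d) (f : Form K n (k * d)) :
    aeval (fun i => (q i f).1) (tildeForm k b q f) =
      (basisDet b (fun i => q i f) ^ k * (((k * d).factorial : K) * ((d.factorial : K)⁻¹) ^ k)) •
        f.1 := by
  rw [mul_smul, ← evalTensor_pow hd b f, ← map_smul, ← smul_pow,
    ← sum_scaledDual_tmul hd b fun i => q i f, Fintype.sum_pow, map_sum, aeval_tildeForm]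
  refine Finset.sum_congr rfl fun I _ => ?_
  rw [prod_tmul, evalTensor_tmul]
  rfl

end Reconstruction

/-! ### Divisibility in factorial rings; zeros of prime polynomials -/

section Divisibility

/-- The gcd of the products h fᵢ is h times the gcd of the fᵢ, and the latter is a unit since no
prime divides it. -/
theorem dvd_of_forall_dvd_mul {R ι : Type*} [CommRing R] [IsDomain R]
    [UniqueFactorizationMonoid R] [Fintype ι] {a h : R} (f : ι → R) (hf : ∃ i, f i ≠ 0)
    (hprime : ∀ π, Prime π → ∃ i, ¬ π ∣ f i) (hdvd : ∀ i, a ∣ h * f i) : a ∣ h := by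
  let := UniqueFactorizationMonoid.strongNormalizationMonoid (α := R)
  let := UniqueFactorizationMonoid.toNormalizedGCDMonoid R
  have h1 : a ∣ Finset.univ.gcd fun i => h * f i := Finset.dvd_gcd fun i _ => hdvd i
  have h2 := (Finset.gcd_mul_left' Finset.univ f h).dvd_iff_dvd_right.mp h1
  have hu : IsUnit (Finset.univ.gcd f) := by
    by_contra hu
    have h0 : Finset.univ.gcd f ≠ 0 := fun h0 => by
      obtain ⟨i, hi⟩ := hf
      exact hi (Finset.gcd_eq_zero_iff.mp h0 i (Finset.mem_univ i))
    obtain ⟨π, hπ, hd⟩ := WfDvdMonoid.exists_irreducible_factor hu h0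
    obtain ⟨i, hi⟩ := hprime π hπ.prime
    exact hi (hd.trans (Finset.gcd_dvd (Finset.mem_univ i)))
  exact hu.dvd_mul_right.mp h2

/-- Polynomials which do not all vanish can be divided by a common factor so that no prime divides
them all. -/
theorem exists_eq_mul_coprime {R ι : Type*} [CommRing R] [IsDomain R]
    [UniqueFactorizationMonoid R] [Fintype ι] (f : ι → R) (hf : ∃ i, f i ≠ 0) :
    ∃ (H : R) (L : ι → R), H ≠ 0 ∧ (∀ i, f i = H * L i) ∧ ∀ π, Prime π → ∃ i, ¬ π ∣ L i := by
  let := UniqueFactorizationMonoid.strongNormalizationMonoid (α := R)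
  let := UniqueFactorizationMonoid.toNormalizedGCDMonoid R
  obtain ⟨i₀, hi₀⟩ := hf
  obtain ⟨L, hL, hL1⟩ := Finset.extract_gcd f (s := Finset.univ) ⟨i₀, Finset.mem_univ i₀⟩
  refine ⟨Finset.univ.gcd f, L, fun h0 => hi₀ (Finset.gcd_eq_zero_iff.mp h0 i₀
    (Finset.mem_univ i₀)), fun i => hL i (Finset.mem_univ i), fun π hπ => ?_⟩
  by_contra! h
  exact hπ.not_isUnit (isUnit_of_dvd_one (hL1 ▸ Finset.dvd_gcd fun i _ => h i))

/-- A hypersurface in an affine space of dimension at least two has a point besides the origin. -/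
theorem exists_zero_of_prime {K : Type*} [Field K] [IsAlgClosed K] {n : ℕ} (hn : 0 < n)
    {π : MvPolynomial (Fin (n + 1)) K} (hπ : Prime π) : ∃ v, v ≠ 0 ∧ eval v π = 0 := by
  by_contra! h
  have hP : (Ideal.span {π}).IsPrime := (Ideal.span_singleton_prime hπ.ne_zero).mpr hπ
  -- By the Nullstellensatz, if π vanishes at most at the origin, it divides every variable; this is
  -- impossible with two non-associated variables.
  have hN := MvPolynomial.IsPrime.vanishingIdeal_zeroLocus (K := K) (Ideal.span {π})
  have hX : ∀ i, π ∣ X i := by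
    intro i
    rw [← Ideal.mem_span_singleton, ← hN, mem_vanishingIdeal_iff]
    intro x hx
    have h0 : eval x π = 0 := by
      have := hx π (Ideal.mem_span_singleton_self π)
      rw [← coe_aeval_eq_eval]
      exact this
    have hx0 : x = 0 := by
      by_contra hne
      exact h x hne h0
    rw [hx0]
    simp
  have h0 : Irreducible (X 0 : MvPolynomial (Fin (n + 1)) K) := (X_prime (R := K)).irreducible
  have hass := hπ.irreducible.associated_of_dvd h0 (hX 0)
  have hdvd : (X 0 : MvPolynomial (Fin (n + 1)) K) ∣ X (Fin.last n) :=
    hass.dvd_iff_dvd_left.mp (hX _)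
  rw [X_dvd_X] at hdvd
  have := congrArg Fin.val hdvd
  simp at this
  omega

end Divisibility

/-! ### Self-maps of ℙⁿ through the Veronese embedding are linear -/

section LinearForms

variable {K : Type*} [Field K] {n d : ℕ}

/-- Total degree is additive over a domain, so L has degree at most 1; its constant term vanishes
because its d-th power does. -/
theorem isHomogeneous_one_of_pow {L : MvPolynomial (Fin (n + 1)) K} (hd : 0 < d)
    (h : (L ^ d).IsHomogeneous d) : L.IsHomogeneous 1 := by
  by_cases hL : L = 0
  · rw [hL]; exact isHomogeneous_zero _ _ _
  have hpow : ∀ e : ℕ, (L ^ e).totalDegree = e * L.totalDegree := by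
    intro e
    induction e with
    | zero => simp
    | succ e ih =>
      rw [pow_succ, totalDegree_mul_of_isDomain (pow_ne_zero _ hL) hL, ih]; ring
  have h1 : L.totalDegree ≤ 1 := by
    have := h.totalDegree_le
    rw [hpow] at this
    by_contra! hc
    nlinarith
  have h0 : coeff 0 L = 0 := by
    have hc : constantCoeff (L ^ d) = 0 := h.coeff_eq_zero (by simpa using hd.ne)
    rw [map_pow] at hc
    exact pow_eq_zero_iff hd.ne' |>.mp hc
  intro α hα
  change Finsupp.weight (fun _ => 1) α = 1
  rw [← Finsupp.degree_eq_weight_one]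
  have hle : α.degree ≤ 1 := (le_totalDegree (mem_support_iff.mpr hα)).trans h1
  have hne : α.degree ≠ 0 := by
    intro hz
    rw [Finsupp.degree_eq_zero_iff] at hz
    exact hα (hz ▸ h0)
  omega

theorem eq_sum_of_isHomogeneous_one {L : MvPolynomial (Fin (n + 1)) K} (h : L.IsHomogeneous 1) :
    L = ∑ l, C (coeff (Finsupp.single l 1) L) * X l := by
  refine ext_of_isHomogeneous h
    (IsHomogeneous.sum _ _ _ fun l _ => isHomogeneous_C_mul_X _ l) fun α => ?_
  obtain ⟨i, hi⟩ : ∃ i, α.1 = Finsupp.single i 1 := by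
    have hα := α.2
    obtain ⟨i, hi⟩ : ∃ i, α.1 i ≠ 0 := by
      by_contra! hc
      rw [show α.1 = 0 from Finsupp.ext hc, map_zero] at hα
      omega
    have hle : Finsupp.single i 1 ≤ α.1 :=
      Finsupp.single_le_iff.mpr (Nat.one_le_iff_ne_zero.mpr hi)
    have h1 := congrArg Finsupp.degree (tsub_add_cancel_of_le hle)
    rw [map_add, hα, Finsupp.degree_single] at h1
    have h2 : (α.1 - Finsupp.single i 1).degree = 0 := by omega
    rw [Finsupp.degree_eq_zero_iff, tsub_eq_zero_iff_le] at h2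
    exact ⟨i, le_antisymm h2 hle⟩
  rw [hi, coeff_sum, Finset.sum_eq_single i]
  · simp
  · intro l _ hl
    rw [coeff_C_mul, coeff_X, if_neg, mul_zero]
    intro e
    exact hl (Finsupp.single_left_injective one_ne_zero e)
  · simp

variable [IsAlgClosed K]

/-- A morphism from `ℙⁿ` to its Veronese embedding given by forms of degree `d` is induced by a
linear change of variables. -/
theorem exists_linear_of_veronese (hn : 0 < n) (hd : 0 < d)
    (g : (Fin (n + 1) →₀ ℕ) → MvPolynomial (Fin (n + 1)) K)
    (hg : ∀ β, β.degree = d → (g β).IsHomogeneous d)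
    (hv : ∀ v : Fin (n + 1) → K, v ≠ 0 → ∃ (u : Fin (n + 1) → K) (a : K), u ≠ 0 ∧ a ≠ 0 ∧
      ∀ β, β.degree = d → eval v (g β) = a * ∏ i, u i ^ β i) :
    ∃ (B : Matrix (Fin (n + 1)) (Fin (n + 1)) K) (c : K), B.det ≠ 0 ∧ c ≠ 0 ∧
      ∀ β : Fin (n + 1) →₀ ℕ, β.degree = d →
        g β = c • ∏ j, (∑ l, C (B j l) * X l) ^ β j := by
  -- The origin is included with a = 0, so that polynomial identities can be tested at every point.
  have hv' : ∀ v : Fin (n + 1) → K, ∃ (u : Fin (n + 1) → K) (a : K),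
      ∀ β, β.degree = d → eval v (g β) = a * ∏ i, u i ^ β i := by
    intro v
    by_cases h : v = 0
    · refine ⟨0, 0, fun β hβ => ?_⟩
      rw [h, zero_mul, eval_zero]
      exact (hg β hβ).coeff_eq_zero (by simpa using hd.ne)
    · obtain ⟨u, a, -, -, h⟩ := hv v h
      exact ⟨u, a, h⟩
  have hsingle : ∀ (u : Fin (n + 1) → K) i e, ∏ t, u t ^ (Finsupp.single i e : _ →₀ ℕ) t =
      u i ^ e := by
    intro u i e
    rw [Finset.prod_eq_single i]
    · rw [Finsupp.single_eq_same]
    · intro t _ ht; rw [Finsupp.single_eq_of_ne ht, pow_zero]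
    · simp
  have hdeg : ∀ i : Fin (n + 1), (Finsupp.single i d).degree = d := fun i =>
    Finsupp.degree_single i d
  have hdeg' : ∀ i j : Fin (n + 1),
      (Finsupp.single i (d - 1) + Finsupp.single j 1).degree = d := fun i j => by
    rw [map_add, Finsupp.degree_single, Finsupp.degree_single, Nat.sub_add_cancel hd]
  have hprod : ∀ (u : Fin (n + 1) → K) i j,
      ∏ t, u t ^ (Finsupp.single i (d - 1) + Finsupp.single j 1 : _ →₀ ℕ) t =
        u i ^ (d - 1) * u j := by
    intro u i j
    simp only [Finsupp.add_apply, pow_add, Finset.prod_mul_distrib, hsingle, pow_one]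
  -- a nonzero coordinate
  obtain ⟨i, hi⟩ : ∃ i, g (Finsupp.single i d) ≠ 0 := by
    have hne : (Pi.single 0 1 : Fin (n + 1) → K) ≠ 0 := by simp
    obtain ⟨u, a, hu, ha, h⟩ := hv _ hne
    obtain ⟨i, hi⟩ := Function.ne_iff.mp hu
    refine ⟨i, fun h0 => ?_⟩
    have := h _ (hdeg i)
    rw [h0, map_zero, hsingle] at this
    exact mul_ne_zero ha (pow_ne_zero d hi) this.symm
  set G := g (Finsupp.single i d) with hG
  let h : Fin (n + 1) → MvPolynomial (Fin (n + 1)) K := fun j =>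
    g (Finsupp.single i (d - 1) + Finsupp.single j 1)
  have hhi : h i = G := by
    simp only [h, hG, ← Finsupp.single_add, Nat.sub_add_cancel hd]
  -- At each point both sides equal a^d uᵢ^{d(d-1)} u^β.
  have hrel : ∀ β : Fin (n + 1) →₀ ℕ, β.degree = d → g β * G ^ (d - 1) = ∏ j, h j ^ β j := by
    intro β hβ
    refine MvPolynomial.funext fun v => ?_
    obtain ⟨u, a, hu⟩ := hv' v
    simp only [map_mul, map_pow, map_prod, h, hG, hu _ hβ, hu _ (hdeg i), hu _ (hdeg' i _), hsingle,
      hprod, mul_pow, Finset.prod_mul_distrib, Finset.prod_pow_eq_pow_sum]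
    rw [← Finsupp.degree_eq_sum, hβ]
    obtain ⟨e, rfl⟩ : ∃ e, d = e + 1 := ⟨d - 1, by omega⟩
    simp only [Nat.add_sub_cancel]
    ring
  obtain ⟨H, L, hH, hL, hLp⟩ := exists_eq_mul_coprime h ⟨i, by rwa [hhi]⟩
  have hrel' : ∀ β : Fin (n + 1) →₀ ℕ, β.degree = d →
      g β * G ^ (d - 1) = H ^ d * ∏ j, L j ^ β j := by
    intro β hβ
    rw [hrel β hβ]
    simp only [hL, mul_pow, Finset.prod_mul_distrib, Finset.prod_pow_eq_pow_sum]
    rw [← Finsupp.degree_eq_sum, hβ]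
  have hsingleL : ∀ i, ∏ t, L t ^ (Finsupp.single i d : _ →₀ ℕ) t = L i ^ d := by
    intro i
    rw [Finset.prod_eq_single i]
    · rw [Finsupp.single_eq_same]
    · intro t _ ht; rw [Finsupp.single_eq_of_ne ht, pow_zero]
    · simp
  -- Both divisions use coprimality. The g β have no common prime factor, since it would vanish at
  -- some v ≠ 0 where they do not all vanish; the L j ^ d have none by the choice of L.
  have hass : Associated (H ^ d) (G ^ (d - 1)) := by
    let := Fintype.ofFinite (Exponent n d)
    refine associated_of_dvd_dvd ?_ ?_
    · refine dvd_of_forall_dvd_mul (fun β : Exponent n d => g β.1) ⟨⟨_, hdeg i⟩, hi⟩ ?_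
        fun β => ?_
      · intro π hπ
        by_contra! hc
        obtain ⟨v, hv0, hvπ⟩ := exists_zero_of_prime hn hπ
        obtain ⟨u, a, hu, ha, hua⟩ := hv v hv0
        obtain ⟨j, hj⟩ := Function.ne_iff.mp hu
        obtain ⟨x, hx⟩ := hc ⟨_, hdeg j⟩
        have := hua _ (hdeg j)
        rw [show g (Finsupp.single j d) = π * x from hx, map_mul, hvπ, zero_mul, hsingle] at this
        exact mul_ne_zero ha (pow_ne_zero d hj) this.symm
      · rw [mul_comm, hrel' _ β.2]
        exact dvd_mul_right _ _
    · refine dvd_of_forall_dvd_mul (fun j => L j ^ d) ⟨i, pow_ne_zero d fun h0 => ?_⟩ ?_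
        fun j => ?_
      · rw [← hhi, hL, h0, mul_zero] at hi
        exact hi rfl
      · intro π hπ
        obtain ⟨j, hj⟩ := hLp π hπ
        exact ⟨j, fun hd => hj (hπ.dvd_of_dvd_pow hd)⟩
      · rw [← hsingleL, ← hrel' _ (hdeg j)]
        exact dvd_mul_left _ _
  obtain ⟨ε, hε⟩ := hass
  obtain ⟨s, hs, hsε⟩ := isUnit_iff_eq_C_of_isReduced.mp ε.isUnit
  have hs0 : s ≠ 0 := hs.ne_zero
  have hfin : ∀ β : Fin (n + 1) →₀ ℕ, β.degree = d → g β = s⁻¹ • ∏ j, L j ^ β j := by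
    intro β hβ
    have h1 := hrel' β hβ
    rw [← hε, hsε, mul_left_comm] at h1
    have h2 := mul_left_cancel₀ (pow_ne_zero d hH) h1
    rw [← h2, mul_comm, ← smul_eq_C_mul, smul_smul, inv_mul_cancel₀ hs0, one_smul]
  have hLhom : ∀ j, (L j).IsHomogeneous 1 := by
    intro j
    refine isHomogeneous_one_of_pow hd ?_
    have h1 := hfin _ (hdeg j)
    rw [hsingleL] at h1
    have h2 := (homogeneousSubmodule _ _ d).smul_mem s (hg _ (hdeg j))
    rwa [h1, smul_smul, mul_inv_cancel₀ hs0, one_smul] at h2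
  let B : Matrix (Fin (n + 1)) (Fin (n + 1)) K := Matrix.of fun j l =>
    coeff (Finsupp.single l 1) (L j)
  have hLB : ∀ j, L j = ∑ l, C (B j l) * X l := fun j => eq_sum_of_isHomogeneous_one (hLhom j)
  refine ⟨B, s⁻¹, fun hdet => ?_, inv_ne_zero hs0, fun β hβ => ?_⟩
  -- At a nonzero vector killed by B all g β would vanish, contrary to the hypothesis on g.
  · obtain ⟨v, hv0, hBv⟩ := Matrix.exists_mulVec_eq_zero_iff.mpr hdet
    obtain ⟨u, a, hu, ha, hua⟩ := hv v hv0
    obtain ⟨j, hj⟩ := Function.ne_iff.mp hu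
    have h1 := hua _ (hdeg j)
    have h2 : eval v (L j) = 0 := by
      rw [hLB, map_sum]
      simp only [map_mul, eval_C, eval_X]
      exact congrFun hBv j
    rw [hfin _ (hdeg j), hsingleL, smul_eval, map_pow, h2, zero_pow hd.ne', mul_zero,
      hsingle] at h1
    exact mul_ne_zero ha (pow_ne_zero d hj) h1.symm
  · rw [hfin β hβ]
    simp only [← hLB]

end LinearForms

/-! ### Change of parametrization and the reconstruction map -/

section Reparametrization

variable {K : Type*} [Field K] {n d r k : ℕ}

theorem isHomogeneous_aeval_tildeForm (b : Fin (r + 1) ≃ Exponent n d)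
    (q : Fin (r + 1) → Form K n (k * d) → Form K n d) (f : Form K n (k * d))
    (q' : Fin (r + 1) → Form K n d) :
    (aeval (fun i => (q' i).1) (tildeForm k b q f)).IsHomogeneous (k * d) := by
  rw [aeval_tildeForm]
  refine IsHomogeneous.sum _ _ _ fun I _ => (homogeneousSubmodule _ _ _).smul_mem _ ?_
  have := IsHomogeneous.prod Finset.univ (fun t : Fin k => (q' (I t)).1) (fun _ => d)
    fun t _ => (q' (I t)).2
  simpa using this

variable [IsAlgClosed K]

/-- Applying to p' the linear change that turns p into Δ times the monomials gives forms that are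
pointwise on the Veronese variety, so they come from a linear substitution. Only one inclusion of
images is needed. -/
theorem exists_eq_smul_actForm (hn : 0 < n) (hd0 : 0 < d)
    (hd : ringChar K = 0 ∨ d < ringChar K) (b : Fin (r + 1) ≃ Exponent n d)
    (p p' : Fin (r + 1) → Form K n d) (hp : basisDet b p ≠ 0)
    (hφ : BasePointFree p) (hφ' : BasePointFree p')
    (hrange : Set.range (projMap p' hφ') ⊆ Set.range (projMap p hφ)) :
    ∃ (A : GL (Fin (n + 1)) K) (c : K), c ≠ 0 ∧ ∀ i, (p' i).1 = c • actDual A (p i).1 := by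
  have hpt : ∀ v : Fin (n + 1) → K, v ≠ 0 → ∃ (u : Fin (n + 1) → K) (a : K), u ≠ 0 ∧ a ≠ 0 ∧
      ∀ i, eval v (p' i).1 = a * eval u (p i).1 := by
    intro v hv
    obtain ⟨x, hx⟩ := hrange ⟨Projectivization.mk K v hv, rfl⟩
    rw [← x.mk_rep, projMap_mk, projMap_mk, eq_comm, Projectivization.mk_eq_mk_iff'] at hx
    obtain ⟨a, ha⟩ := hx
    refine ⟨x.rep, a, x.rep_nonzero, ?_, fun i => (congrFun ha i).symm⟩
    rintro rfl
    rw [zero_smul] at ha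
    exact hφ' v hv ha.symm
  -- These coefficients express Δ x^β through the pᵢ; here they are applied to the p'ᵢ instead.
  let g : (Fin (n + 1) →₀ ℕ) → SymDual K n := fun β =>
    ∑ i, pairing (scaledDual b p i).1 (monomial β 1) • (p' i).1
  obtain ⟨B, c, hB, hc, hBc⟩ := exists_linear_of_veronese hn hd0 g
    (fun β _ => IsHomogeneous.sum _ _ _ fun i _ =>
      (homogeneousSubmodule _ _ d).smul_mem _ (p' i).2) (by
    intro v hv
    obtain ⟨u, a, hu, ha, h⟩ := hpt v hv
    refine ⟨u, a * basisDet b p, hu, mul_ne_zero ha hp, fun β hβ => ?_⟩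
    have h1 := congrArg (eval u) (sum_pairing_scaledDual_smul hd b p
      (isHomogeneous_monomial (R := K) (1 : K) hβ))
    rw [smul_eval, eval_monomial_one] at h1
    rw [mul_assoc, ← h1]
    simp only [g, map_sum, smul_eval, h, Finset.mul_sum]
    exact Finset.sum_congr rfl fun i _ => by ring)
  -- The inverse appears because the contragredient action substitutes with the rows of A⁻¹.
  let A : GL (Fin (n + 1)) K := (Matrix.GeneralLinearGroup.mkOfDetNeZero B hB)⁻¹
  have hA : ((A⁻¹ : GL (Fin (n + 1)) K) : Matrix _ _ K) = B := by
    simp only [A, inv_inv]; rfl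
  have hact : ∀ β : Fin (n + 1) →₀ ℕ, actDual A (monomial β 1) =
      ∏ j, (∑ l, C (B j l) * X l : SymDual K n) ^ β j := by
    intro β
    rw [actDual, hA, aeval_monomial, map_one, one_mul,
      Finsupp.prod_fintype _ _ fun i => pow_zero _]
  refine ⟨A, (basisDet b p)⁻¹ * c, mul_ne_zero (inv_ne_zero hp) hc, fun i => ?_⟩
  have h1 : ∑ j, coeff (b j).1 (p i).1 • g (b j).1 = basisDet b p • (p' i).1 := by
    simp only [g, Finset.smul_sum, smul_smul]
    rw [Finset.sum_comm]
    simp only [← Finset.sum_smul]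
    have h2 : ∀ l, ∑ j, coeff (b j).1 (p i).1 * pairing (scaledDual b p l).1 (monomial (b j).1 1) =
        if l = i then basisDet b p else 0 := by
      intro l
      rw [← pairing_scaledDual_self hd b p l i]
      conv_rhs => rw [eq_sum_coeff_smul b (p i).2]
      simp only [map_sum, map_smul, smul_eq_mul]
    simp only [h2, ite_smul, zero_smul]
    simp
  have h3 : (p' i).1 = (basisDet b p)⁻¹ • ∑ j, coeff (b j).1 (p i).1 • g (b j).1 := by
    rw [h1, smul_smul, inv_mul_cancel₀ hp, one_smul]
  rw [h3, mul_smul]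
  congr 1
  conv_rhs => rw [eq_sum_coeff_smul b (p i).2]
  simp only [map_sum, map_smul, Finset.smul_sum, hact]
  refine Finset.sum_congr rfl fun j _ => ?_
  rw [hBc _ (b j).2, smul_comm]

/-- Substituting a·x for x, with a an e-th root of s, multiplies a form of degree e by s. -/
theorem glEquivalent_smul_actDual {e : ℕ} (he : 0 < e) {f : SymDual K n} (hf : f.IsHomogeneous e)
    {s : K} (hs : s ≠ 0) (A : GL (Fin (n + 1)) K) : GLEquivalent f (s • actDual A f) := by
  obtain ⟨a, ha⟩ := IsAlgClosed.exists_pow_nat_eq s he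
  have ha0 : a ≠ 0 := by
    rintro rfl
    rw [zero_pow he.ne'] at ha
    exact hs ha.symm
  let S : GL (Fin (n + 1)) K := (Matrix.GeneralLinearGroup.mkOfDetNeZero
    (Matrix.diagonal fun _ => a) (by
      rw [Matrix.det_diagonal]; exact Finset.prod_ne_zero_iff.mpr fun _ _ => ha0))⁻¹
  have hS : ((S⁻¹ : GL (Fin (n + 1)) K) : Matrix (Fin (n + 1)) (Fin (n + 1)) K) =
      Matrix.diagonal fun _ => a := by
    simp only [S, inv_inv]; rfl
  refine ⟨A * S, ?_⟩
  rw [actDual_mul, ← map_smul]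
  congr 1
  refine MvPolynomial.funext fun v => ?_
  rw [actDual, eval_aeval, smul_eval, ← ha, ← eval_smul_of_isHomogeneous hf, hS]
  congr 2
  funext j
  rw [map_sum, Finset.sum_eq_single j]
  · simp
  · intro i _ hi; simp [Matrix.diagonal_apply_ne' _ hi]
  · simp

/-- Each term of f̃ is a product of k variables, so the scalar relating q' to A • q(f) comes out as
its k-th power. With Δ^k (kd)!/(d!)^k it gives a nonzero multiple of A • f. -/
theorem glEquivalent_aeval_tildeForm (hn : 0 < n) (hk0 : 0 < k) (hd0 : 0 < d)
    (hk : ringChar K = 0 ∨ k * d < ringChar K) (hd : ringChar K = 0 ∨ d < ringChar K)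
    (b : Fin (r + 1) ≃ Exponent n d)
    (q : Fin (r + 1) → Form K n (k * d) → Form K n d) (f : Form K n (k * d))
    (hf : basisDet b (fun i => q i f) ≠ 0) (hφ : BasePointFree fun i => q i f)
    (q' : Fin (r + 1) → Form K n d) (hφ' : BasePointFree q')
    (hrange : Set.range (projMap q' hφ') ⊆ Set.range (projMap (fun i => q i f) hφ)) :
    GLEquivalent f.1 (aeval (fun i => (q' i).1) (tildeForm k b q f)) := by
  obtain ⟨A, c, hc, h⟩ := exists_eq_smul_actForm hn hd0 hd b _ q' hf hφ hφ' hrange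
  have h1 : aeval (fun i => (q' i).1) (tildeForm k b q f) =
      c ^ k • actDual A (aeval (fun i => (q i f).1) (tildeForm k b q f)) := by
    rw [aeval_tildeForm, aeval_tildeForm, map_sum, Finset.smul_sum]
    refine Finset.sum_congr rfl fun I _ => ?_
    rw [map_smul, smul_comm, map_prod]
    simp only [h]
    rw [Finset.prod_smul]
    simp
  rw [h1, aeval_tildeForm_self hd, map_smul, smul_smul]
  refine glEquivalent_smul_actDual (Nat.mul_pos hk0 hd0) f.2 ?_ A
  exact mul_ne_zero (pow_ne_zero _ hc) (mul_ne_zero (pow_ne_zero _ hf)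
    (mul_ne_zero (factorial_ne_zero_of_lt_ringChar hk)
      (pow_ne_zero _ (inv_ne_zero (factorial_ne_zero_of_lt_ringChar hd)))))

open Classical in
/-- Evaluates a polynomial at some parametrization, by forms of degree `d` without common zero, of
the zero locus of a set of forms. -/
def reconstruct (K : Type*) [Field K] (n d r k : ℕ) (F : MvPolynomial (Fin (r + 1)) K)
    (S : Set (MvPolynomial (Fin (r + 1)) K)) : Form K n (k * d) :=
  -- The homogeneity clause only makes the value a form; it holds automatically when F is some f̃.
  if h : ∃ q' : Fin (r + 1) → Form K n d, (∃ hφ' : BasePointFree q',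
      Set.range (projMap q' hφ') = zeroLocus S) ∧
      (aeval (fun i => (q' i).1) F).IsHomogeneous (k * d) then
    ⟨aeval (fun i => (h.choose i).1) F, h.choose_spec.2⟩
  else 0

/-- The qᵢ(f) themselves show that a parametrization exists, and whichever one is chosen gives an
equivalent form. -/
theorem glEquivalent_reconstruct (hn : 0 < n) (hk0 : 0 < k) (hd0 : 0 < d)
    (hk : ringChar K = 0 ∨ k * d < ringChar K) (hd : ringChar K = 0 ∨ d < ringChar K)
    (b : Fin (r + 1) ≃ Exponent n d)
    (q : Fin (r + 1) → Form K n (k * d) → Form K n d) (f : Form K n (k * d))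
    (hf : basisDet b (fun i => q i f) ≠ 0) (hφ : BasePointFree fun i => q i f)
    {S : Set (MvPolynomial (Fin (r + 1)) K)}
    (hS : zeroLocus S = Set.range (projMap (fun i => q i f) hφ)) :
    GLEquivalent f.1 (reconstruct K n d r k (tildeForm k b q f) S).1 := by
  have h : ∃ q' : Fin (r + 1) → Form K n d, (∃ hφ' : BasePointFree q',
      Set.range (projMap q' hφ') = zeroLocus S) ∧
      (aeval (fun i => (q' i).1) (tildeForm k b q f)).IsHomogeneous (k * d) :=
    ⟨_, ⟨hφ, hS.symm⟩, isHomogeneous_aeval_tildeForm b q f _⟩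
  rw [reconstruct, dif_pos h]
  obtain ⟨hφ', hr⟩ := h.choose_spec.1
  exact glEquivalent_aeval_tildeForm hn hk0 hd0 hk hd b q f hf hφ _ hφ' (hr.trans hS).subset

end Reparametrization

end

end HypersurfaceReconstruction

/-! ### Assembly of the assertions -/

open HypersurfaceReconstruction in
theorem mainTheorem1 {K : Type*} [Field K] [IsAlgClosed K] (n k d r : ℕ)
    (hn : 0 < n) (hk : 0 < k) (hd : 0 < d)
    (hchar : ringChar K = 0 ∨ k * d < ringChar K)
    (hr : r + 1 = Module.finrank K (Form K n d))
    (b : Fin (r + 1) ≃ Exponent n d) :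
    -- a reconstruction procedure that sees only `f̃` and the quadrics
    ∃ R : MvPolynomial (Fin (r + 1)) K → Set (MvPolynomial (Fin (r + 1)) K) → Form K n (k * d),
    ∀ q : Fin (r + 1) → Form K n (k * d) → Form K n d, (∀ i, IsCovariant (q i)) →
      -- `Δ` is an invariant and the `Δ qᵢ*` are contravariants, dual to the `qᵢ` up to `Δ`
      (IsInvariant (fun g => basisDet b (fun i => q i g)) ∧
        (∀ i, IsContravariant (fun g => scaledDual b (fun i => q i g) i)) ∧
        (∀ g i j, apolar (scaledDual b (fun i => q i g) i).1 (q j g).1 =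
          C (if i = j then basisDet b (fun i => q i g) else 0)) ∧
        (∀ g, LinearIndependent K (fun i => q i g) ↔ basisDet b (fun i => q i g) ≠ 0)) ∧
      -- the coefficients of `f̃` are invariants
      (∀ I : Fin k → Fin (r + 1), IsInvariant (tildeCoeff b q I)) ∧
      (∀ γ : Fin (r + 1) →₀ ℕ, IsInvariant (fun g => coeff γ (tildeForm k b q g))) ∧
      -- quadrics defining the image of `φ`, with invariants as coefficients
      (∃ (s : ℕ) (c : Fin s → Fin (r + 1) × Fin (r + 1) → Form K n (k * d) → K),
        (∀ t lm, IsInvariant (c t lm)) ∧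
        ∀ f : Form K n (k * d), LinearIndependent K (fun i => q i f) →
          ∃ hφ : BasePointFree (fun i => q i f),
            zeroLocus (Set.range fun t => quadric fun lm => c t lm f) =
              Set.range (projMap (fun i => q i f) hφ) ∧
            ∀ P : MvPolynomial (Fin (r + 1)) K, P.IsHomogeneous 2 →
              (aeval (fun i => (q i f).1) P = 0 ↔
                P ∈ Submodule.span K (Set.range fun t => quadric fun lm => c t lm f))) ∧
      -- the quadrics as the right kernel of a matrix of invariants
      (∀ ij lm, IsInvariant (fun g => relationMatrix b q g ij lm)) ∧
      ((ringChar K = 0 ∨ 2 * d < ringChar K) →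
        ∀ f : Form K n (k * d), LinearIndependent K (fun i => q i f) →
          (∀ c : Fin (r + 1) × Fin (r + 1) → K, (relationMatrix b q f).mulVec c = 0 ↔
            aeval (fun i => (q i f).1) (quadric c) = 0) ∧
          ∃ hφ : BasePointFree (fun i => q i f),
            zeroLocus {Q | ∃ c, (relationMatrix b q f).mulVec c = 0 ∧ Q = quadric c} =
              Set.range (projMap (fun i => q i f) hφ)) ∧
      -- `f̃` and any quadrics defining the image of `φ` determine some `f'` equivalent to `f`
      (∀ f : Form K n (k * d), LinearIndependent K (fun i => q i f) →
        ∀ (hφ : BasePointFree (fun i => q i f)) (s : ℕ)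
          (Q : Fin s → MvPolynomial (Fin (r + 1)) K), (∀ t, (Q t).IsHomogeneous 2) →
          zeroLocus (Set.range Q) = Set.range (projMap (fun i => q i f) hφ) →
          GLEquivalent f.1 (R (tildeForm k b q f) (Set.range Q)).1 ∧
          ∀ (q' : Fin (r + 1) → Form K n d) (hφ' : BasePointFree q'),
            Set.range (projMap q' hφ') = zeroLocus (Set.range Q) →
            GLEquivalent f.1 (aeval (fun i => (q' i).1) (tildeForm k b q f))) := by
  have hd' : ringChar K = 0 ∨ d < ringChar K :=
    hchar.imp_right fun h => (Nat.le_mul_of_pos_left d hk).trans_lt h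
  refine ⟨reconstruct K n d r k, fun q hq => ⟨⟨isInvariant_basisDet hn b hq,
    isContravariant_scaledDual hn hd' b hq, fun g => apolar_scaledDual hd' b fun i => q i g,
    fun g => linearIndependent_iff_basisDet_ne_zero b fun i => q i g⟩,
    isInvariant_tildeCoeff hn hd' b hq, isInvariant_coeff_tildeForm hn hd' b hq k, ?_,
    isInvariant_relationMatrix hn hd' b hq, ?_, ?_⟩⟩
  -- One family of invariants for each six-tuple of indices, so s = (r + 1)^6, independently of f.
  · let e := (Fintype.equivFin (Fin 6 → Fin (r + 1))).symm
    refine ⟨_, fun t => relationCoeff b q (e t),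
      fun t lm => isInvariant_relationCoeff hn hd' b hq (e t) lm, fun f hf => ?_⟩
    rw [linearIndependent_iff_basisDet_ne_zero b] at hf
    have hφ := basePointFree_of_basisDet_ne_zero b hd' _ hf
    have hrange : (Set.range fun t => quadric fun lm => relationCoeff b q (e t) lm f) =
        Set.range fun t => tensorQuadric b (fun i => q i f)
          (relationTensor b (fun i => q i f) t) := by
      simp only [tensorQuadric_eq_quadric]
      exact e.surjective.range_comp fun t => quadric fun lm => relationCoeff b q t lm f
    rw [hrange]
    have hmem := fun {P : MvPolynomial (Fin (r + 1)) K} (hP : P.IsHomogeneous 2) =>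
      mem_relationSpan_iff hd hd' b _ hf hP
    refine ⟨hφ, zeroLocus_eq_range_projMap hd hd' b _ hf hφ ?_ fun P hP => (hmem hP).mp,
      fun P hP => hmem hP⟩
    rintro _ ⟨t, rfl⟩
    refine ⟨?_, aeval_tensorQuadric_relationTensor hd hd' b _ t⟩
    simp only [tensorQuadric_eq_quadric]
    exact isHomogeneous_quadric _
  · intro hd2 f hf
    rw [linearIndependent_iff_basisDet_ne_zero b] at hf
    have hφ := basePointFree_of_basisDet_ne_zero b hd' _ hf
    have hM := relationMatrix_mulVec_eq_zero_iff hd' hd2 b q f hf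
    refine ⟨hM, hφ, zeroLocus_eq_range_projMap hd hd' b _ hf hφ ?_ fun P hP h => ?_⟩
    · rintro _ ⟨c, hc, rfl⟩
      exact ⟨isHomogeneous_quadric c, (hM c).mp hc⟩
    · obtain ⟨c, rfl⟩ := exists_eq_quadric hP
      exact Submodule.subset_span ⟨c, (hM c).mpr h, rfl⟩
  · intro f hf hφ s Q _ hS
    rw [linearIndependent_iff_basisDet_ne_zero b] at hf
    exact ⟨glEquivalent_reconstruct hn hk hd hchar hd' b q f hf hφ hS, fun q' hφ' h =>
      glEquivalent_aeval_tildeForm hn hk hd hchar hd' b q f hf hφ q' hφ' (h.trans hS).subset⟩
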